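/- **Notation.** $\Delta_m$ is the probability simplex in $\mathbb{R}^m$. For $r\in\Delta_m$, $c\in\Delta_n$ let $\Pi(r,c)$ be the set of matrices $X\in\mathbb{R}_{\ge 0}^{m\times n}$ with $X\mathbb{1}=r$ and $X^\top\mathbb{1}=c$. Write $\|X\|_1=\sum_{ij}|X_{ij}|$, $\|C\|_\infty=\max_{ij}|C_{ij}|$, $H(X)=-\sum_{ij}X_{ij}\log X_{ij}$ (with $0\log 0=0$), and $b=\min_{i,j}\{r_i,c_j\}$. Exponentials, minima and quotients of matrices and vectors are entrywise. **Algorithms.** All of them compute with exact real numbers. Each arithmetic operation, $\exp$, $\log$, comparison and write of an array entry takes one unit of time. * $\mathtt{Sinkhorn}(K,r,c,\varepsilon')$: put $k=0$, $X_0=K/\|K\|_1$, $u^0=0$, $v^0=0$. While $\|X_k\mathbb{1}-r\|_1+\|X_k^\top\mathbb{1}-c\|_1>\varepsilon'$: increase $k$ by one; if $k$ is odd, put $u^k=u^{k-1}+\log(r/(X_{k-1}\mathbb{1}))$ and $v^k=v^{k-1}$; if $k$ is even, put $v^k=v^{k-1}+\log(c/(X_{k-1}^\top\mathbb{1}))$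 and $u^k=u^{k-1}$; then put $X_k=\operatorname{diag}(e^{u^k})\,K\,\operatorname{diag}(e^{v^k})$. Return $X_k$. * $\mathtt{Round}(F,\Pi(r,c))$: put $F'=\operatorname{diag}(\min(r/(F\mathbb{1}),1))\,F$, then $F''=F'\operatorname{diag}(\min(c/(F'^\top\mathbb{1}),1))$, $e_r=r-F''\mathbb{1}$, $e_c=c-F''^\top\mathbb{1}$. Return $F''+e_re_c^\top/\|e_r\|_1$ (and $F''$ if $e_r=0$). * $\mathtt{ApproxOT}(r,c,C,\xi,\varepsilon)$: restrict $r$, $c$, $C$ to the indices $i,j$ with $r_i>0$, $c_j>0$. With the restricted data, put $J=\xi\|C\|_\infty-\log\min_{i,j}\{r_i,c_j\}$, $K=e^{-\xi C}$, and $\varepsilon'=\varepsilon^2/(8J)$ if the number of rows or of columns exceeds $2$, $\varepsilon'=\varepsilon^2\log 2/(8J)$ otherwise ($\varepsilon'=0$ in the trivial case $J=0$, in which there are only one row and one column). Compute $X'=\mathtt{Sinkhorn}(K,r,c,\varepsilon')$ and $\mathtt{Round}(X',\Pi(r,c))$, and return the latter, extended by zeros to an $m\times n$ matrix $\hat X$.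 **Lemma.** There are universal constants $A\in\mathbb{R}$ and $p\in\mathbb{N}$ such that the following holds for all $m,n$, all $r\in\Delta_m$ and $c\in\Delta_n$ with all entries positive, all $C\in\mathbb{R}_{\ge 0}^{m\times n}$, $\xi>0$ and $\varepsilon\in(0,1)$. The problem of minimizing $\langle X,C\rangle-\frac1\xi H(X)$ over $X\in\Pi(r,c)$ has exactly one solution $X^*_\xi$, and $\mathtt{ApproxOT}(r,c,C,\xi,\varepsilon)$ terminates and returns a coupling $\hat X\in\Pi(r,c)$ with $$\|\hat X-X^*_\xi\|_1\le\varepsilon$$ after a time $T$ with $$T\le A\,(1+\log(mn))^p\Bigl(mn\,\varepsilon^{-4}\,\xi\|C\|_\infty\bigl(\xi^2\|C\|_\infty^2+(\log b^{-1})^2\bigr)+mn\Bigr),$$ that is, in time $\tilde{\mathcal O}\bigl(mn\,\varepsilon^{-4}\xi\|C\|_\infty(\xi^2\|C\|_\infty^2+(\log b^{-1})^2)+mn\bigr)$, where $\tilde{\mathcal O}$ hides only powers of $1+\log(mn)$. -/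

import Mathlib

noncomputable section

namespace EntropicOT

/-! ### Entropic optimal transport -/

/-- The couplings of `r` and `c`: nonnegative matrices with row sums `r` and column sums `c`. -/
def couplings {ι κ : Type} [Fintype ι] [Fintype κ] (r : ι → ℝ) (c : κ → ℝ) : Set (ι → κ → ℝ) :=
  {X | (∀ i j, 0 ≤ X i j) ∧ (∀ i, ∑ j, X i j = r i) ∧ (∀ j, ∑ i, X i j = c j)}

/-- The Shannon entropy `H(X) = -∑ X_ij log X_ij`, with `0 log 0 = 0`. -/
def entropy {ι κ : Type} [Fintype ι] [Fintype κ] (X : ι → κ → ℝ) : ℝ :=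
  -∑ i, ∑ j, X i j * Real.log (X i j)

/-- The objective `⟨X, C⟩ - H(X) / ξ`. -/
def objective {ι κ : Type} [Fintype ι] [Fintype κ] (C : ι → κ → ℝ) (ξ : ℝ) (X : ι → κ → ℝ) : ℝ :=
  (∑ i, ∑ j, X i j * C i j) - 1 / ξ * entropy X

/-- `X` is an optimal solution of the entropic optimal transport problem. -/
def IsOptimal {ι κ : Type} [Fintype ι] [Fintype κ] (r : ι → ℝ) (c : κ → ℝ) (C : ι → κ → ℝ)
    (ξ : ℝ) (X : ι → κ → ℝ) : Prop :=
  X ∈ couplings r c ∧ IsMinOn (objective C ξ) (couplings r c) X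

/-- The entrywise norm `‖X‖₁ = ∑ |X_ij|`. -/
def norm1 {ι κ : Type} [Fintype ι] [Fintype κ] (X : ι → κ → ℝ) : ℝ := ∑ i, ∑ j, |X i j|

/-- The entrywise norm `‖C‖_∞ = max |C_ij|`. -/
def normInf {ι κ : Type} (C : ι → κ → ℝ) : ℝ := ⨆ i, ⨆ j, |C i j|

/-- `min {r_i, c_j}`, the smallest entry of the two vectors. -/
def minEntry {ι κ : Type} (r : ι → ℝ) (c : κ → ℝ) : ℝ := min (⨅ i, r i) (⨅ j, c j)

/-! ### Real-number computations with a step count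

Every arithmetic operation, `exp`, `log`, comparison, and write of an array entry is one step. -/

/-- The result of a terminating computation, with the number of steps it took. -/
structure Timed (α : Type) where
  val : α
  cost : ℕ

instance : Monad Timed where
  pure a := ⟨a, 0⟩
  bind x f := ⟨(f x.val).val, x.cost + (f x.val).cost⟩

namespace Timed

def add (x y : ℝ) : Timed ℝ := ⟨x + y, 1⟩
def sub (x y : ℝ) : Timed ℝ := ⟨x - y, 1⟩
def mul (x y : ℝ) : Timed ℝ := ⟨x * y, 1⟩
def div (x y : ℝ) : Timed ℝ := ⟨x / y, 1⟩
def neg (x : ℝ) : Timed ℝ := ⟨-x, 1⟩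
def abs (x : ℝ) : Timed ℝ := ⟨|x|, 1⟩
def min (x y : ℝ) : Timed ℝ := ⟨Min.min x y, 1⟩
def exp (x : ℝ) : Timed ℝ := ⟨Real.exp x, 1⟩
def log (x : ℝ) : Timed ℝ := ⟨Real.log x, 1⟩
def lt (x y : ℝ) : Timed Bool := ⟨decide (x < y), 1⟩
def natSucc (k : ℕ) : Timed ℕ := ⟨k + 1, 1⟩
def natOdd (k : ℕ) : Timed Bool := ⟨decide (k % 2 = 1), 1⟩
def natMax (k l : ℕ) : Timed ℕ := ⟨Max.max k l, 1⟩
def natLe (k l : ℕ) : Timed Bool := ⟨decide (k ≤ l), 1⟩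

/-- A loop over the index set that computes an array; one extra step per entry for the write. -/
def tabulate {ι α : Type} [Fintype ι] (f : ι → Timed α) : Timed (ι → α) :=
  ⟨fun i => (f i).val, ∑ i, ((f i).cost + 1)⟩

/-- A loop that adds up the values of `f`; one extra step per term for the addition. -/
def sum {ι : Type} [Fintype ι] (f : ι → Timed ℝ) : Timed ℝ :=
  ⟨∑ i, (f i).val, ∑ i, ((f i).cost + 1)⟩

/-- A loop that finds the largest value of `f`; one extra step per term for the comparison. -/
def maximum {ι : Type} [Fintype ι] (f : ι → Timed ℝ) : Timed ℝ :=
  ⟨⨆ i, (f i).val, ∑ i, ((f i).cost + 1)⟩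

/-- A loop that finds the smallest value of `f`; one extra step per term for the comparison. -/
def minimum {ι : Type} [Fintype ι] (f : ι → Timed ℝ) : Timed ℝ :=
  ⟨⨅ i, (f i).val, ∑ i, ((f i).cost + 1)⟩

/-- `WhileRuns test body s s' t`: the loop `while test do body`, started in the state `s`,
terminates in the state `s'` after `t` steps. -/
inductive WhileRuns {σ : Type} (test : σ → Timed Bool) (body : σ → Timed σ) : σ → σ → ℕ → Prop
  | finished (s : σ) (h : (test s).val = false) : WhileRuns test body s s (test s).cost
  | step (s s' : σ) (t : ℕ) (h : (test s).val = true)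
      (hrun : WhileRuns test body (body s).val s' t) :
      WhileRuns test body s s' ((test s).cost + (body s).cost + t)

/-- A loop has at most one result and one running time. -/
theorem WhileRuns.unique {σ : Type} {test : σ → Timed Bool} {body : σ → Timed σ} {s s₁ s₂ : σ}
    {t₁ t₂ : ℕ} (h₁ : WhileRuns test body s s₁ t₁) (h₂ : WhileRuns test body s s₂ t₂) :
    s₁ = s₂ ∧ t₁ = t₂ := by
  induction h₁ generalizing s₂ t₂ with
  | finished s h =>
    cases h₂ with
    | finished => exact ⟨rfl, rfl⟩
    | step _ _ _ h' => simp [h] at h'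
  | step s s' t h _ ih =>
    cases h₂ with
    | finished _ h' => simp [h] at h'
    | step _ _ _ _ hrun =>
      obtain ⟨h1, h2⟩ := ih hrun
      exact ⟨h1, by rw [h2]⟩

end Timed

open Timed

/-! ### Linear algebra subroutines -/

def rowSums {ι κ : Type} [Fintype ι] [Fintype κ] (X : ι → κ → ℝ) : Timed (ι → ℝ) :=
  tabulate fun i => Timed.sum fun j => pure (X i j)

def colSums {ι κ : Type} [Fintype ι] [Fintype κ] (X : ι → κ → ℝ) : Timed (κ → ℝ) :=
  tabulate fun j => Timed.sum fun i => pure (X i j)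

def vecSub {ι : Type} [Fintype ι] (x y : ι → ℝ) : Timed (ι → ℝ) :=
  tabulate fun i => Timed.sub (x i) (y i)

def vecAdd {ι : Type} [Fintype ι] (x y : ι → ℝ) : Timed (ι → ℝ) :=
  tabulate fun i => Timed.add (x i) (y i)

def vecNorm1 {ι : Type} [Fintype ι] (x : ι → ℝ) : Timed ℝ :=
  Timed.sum fun i => Timed.abs (x i)

/-- `log (x_i / y_i)` for all `i`. -/
def logRatio {ι : Type} [Fintype ι] (x y : ι → ℝ) : Timed (ι → ℝ) :=
  tabulate fun i => do
    let q ← Timed.div (x i) (y i)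
    Timed.log q

/-- `min (x_i / y_i) 1` for all `i`. -/
def cappedRatio {ι : Type} [Fintype ι] (x y : ι → ℝ) : Timed (ι → ℝ) :=
  tabulate fun i => do
    let q ← Timed.div (x i) (y i)
    Timed.min q 1

/-- `diag(e^u) K diag(e^v)`. -/
def scaled {ι κ : Type} [Fintype ι] [Fintype κ] (K : ι → κ → ℝ) (u : ι → ℝ) (v : κ → ℝ) :
    Timed (ι → κ → ℝ) := do
  let a ← tabulate fun i => Timed.exp (u i)
  let b ← tabulate fun j => Timed.exp (v j)
  tabulate fun i => tabulate fun j => do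
    let z ← Timed.mul (a i) (K i j)
    Timed.mul z (b j)

/-! ### The algorithm `Sinkhorn` -/

/-- The variables `k, X_k, u^k, v^k`. -/
structure SinkhornState (ι κ : Type) where
  k : ℕ
  X : ι → κ → ℝ
  u : ι → ℝ
  v : κ → ℝ

/-- `k ← 0`, `X_0 ← K / ‖K‖₁`, `u^0 ← 0`, `v^0 ← 0`. -/
def sinkhornInit {ι κ : Type} [Fintype ι] [Fintype κ] (K : ι → κ → ℝ) :
    Timed (SinkhornState ι κ) := do
  let s ← Timed.sum fun i => Timed.sum fun j => Timed.abs (K i j)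
  let X ← tabulate fun i => tabulate fun j => Timed.div (K i j) s
  let u ← tabulate fun _ => pure 0
  let v ← tabulate fun _ => pure 0
  pure ⟨0, X, u, v⟩

/-- The loop condition `‖X_k 1 - r‖₁ + ‖X_kᵀ 1 - c‖₁ > ε'`. -/
def sinkhornTest {ι κ : Type} [Fintype ι] [Fintype κ] (r : ι → ℝ) (c : κ → ℝ) (ε' : ℝ)
    (s : SinkhornState ι κ) : Timed Bool := do
  let r' ← rowSums s.X
  let c' ← colSums s.X
  let dr ← vecSub r' r
  let dc ← vecSub c' c
  let er ← vecNorm1 dr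
  let ec ← vecNorm1 dc
  let e ← Timed.add er ec
  Timed.lt ε' e

/-- The loop body: `k ← k + 1`, then the row potential is updated if `k` is odd and the column
potential if `k` is even, then `X_k ← diag(e^{u^k}) K diag(e^{v^k})`. -/
def sinkhornBody {ι κ : Type} [Fintype ι] [Fintype κ] (K : ι → κ → ℝ) (r : ι → ℝ) (c : κ → ℝ)
    (s : SinkhornState ι κ) : Timed (SinkhornState ι κ) := do
  let k ← natSucc s.k
  let isOdd ← natOdd k
  if isOdd then
    let r' ← rowSums s.X
    let w ← logRatio r r'
    let u ← vecAdd s.u w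
    let X ← scaled K u s.v
    pure ⟨k, X, u, s.v⟩
  else
    let c' ← colSums s.X
    let w ← logRatio c c'
    let v ← vecAdd s.v w
    let X ← scaled K s.u v
    pure ⟨k, X, s.u, v⟩

/-- `Sinkhorn(K, r, c, ε')` terminates, returns `X`, and takes `t` steps. -/
def SinkhornRuns {ι κ : Type} [Fintype ι] [Fintype κ] (K : ι → κ → ℝ) (r : ι → ℝ) (c : κ → ℝ)
    (ε' : ℝ) (X : ι → κ → ℝ) (t : ℕ) : Prop :=
  ∃ (s : SinkhornState ι κ) (tl : ℕ),
    WhileRuns (sinkhornTest r c ε') (sinkhornBody K r c) (sinkhornInit K).val s tl ∧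
    X = s.X ∧ t = (sinkhornInit K).cost + tl

/-! ### The algorithm `Round` -/

/-- `Round(F, Π(r, c))`. If `err_r = 0`, the quotient in the last line is read as `0`. -/
def round {ι κ : Type} [Fintype ι] [Fintype κ] (F : ι → κ → ℝ) (r : ι → ℝ) (c : κ → ℝ) :
    Timed (ι → κ → ℝ) := do
  let r' ← rowSums F
  let x ← cappedRatio r r'
  let F' ← tabulate fun i => tabulate fun j => Timed.mul (x i) (F i j)
  let c' ← colSums F'
  let y ← cappedRatio c c'
  let F'' ← tabulate fun i => tabulate fun j => Timed.mul (F' i j) (y j)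
  let r'' ← rowSums F''
  let c'' ← colSums F''
  let errR ← vecSub r r''
  let errC ← vecSub c c''
  let N ← vecNorm1 errR
  tabulate fun i => tabulate fun j => do
    let p ← Timed.mul (errR i) (errC j)
    let q ← Timed.div p N
    Timed.add (F'' i j) q

/-! ### The algorithm `ApproxOT` -/

/-- The set of indices of the positive entries of `r`. -/
abbrev Pos {m : ℕ} (r : Fin m → ℝ) : Type := {i : Fin m // 0 < r i}

/-- The data with which `Sinkhorn` and `Round` are called. -/
structure Restricted {m n : ℕ} (r : Fin m → ℝ) (c : Fin n → ℝ) where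
  rPos : Pos r → ℝ
  cPos : Pos c → ℝ
  K : Pos r → Pos c → ℝ
  ε' : ℝ

/-- Restriction to the positive entries of the marginals, and choice of the parameters
`J = ξ ‖C‖_∞ - log min {r_i, c_j}`, `K = exp(-ξ C)` and `ε' = ε² / (8 J)`
(`ε' = ε² log 2 / (8 J)` if there are at most two rows and at most two columns). -/
def prepare {m n : ℕ} (r : Fin m → ℝ) (c : Fin n → ℝ) (C : Fin m → Fin n → ℝ) (ξ ε : ℝ) :
    Timed (Restricted r c) := do
  -- the scans that find the positive entries
  let _ ← tabulate fun i => Timed.lt 0 (r i)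
  let _ ← tabulate fun j => Timed.lt 0 (c j)
  let rPos ← tabulate fun i : Pos r => pure (r i)
  let cPos ← tabulate fun j : Pos c => pure (c j)
  let CPos ← tabulate fun i : Pos r => tabulate fun j : Pos c => pure (C i j)
  -- the parameters
  let M ← Timed.maximum fun i => Timed.maximum fun j => Timed.abs (CPos i j)
  let bR ← Timed.minimum fun i => pure (rPos i)
  let bC ← Timed.minimum fun j => pure (cPos j)
  let b ← Timed.min bR bC
  let lb ← Timed.log b
  let ξM ← Timed.mul ξ M
  let J ← Timed.sub ξM lb
  let J8 ← Timed.mul 8 J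
  let ε2 ← Timed.mul ε ε
  let e ← Timed.div ε2 J8
  let d ← natMax (Fintype.card (Pos r)) (Fintype.card (Pos c))
  let isSmall ← natLe d 2
  let l2 ← Timed.log 2
  let eSmall ← Timed.mul e l2
  let K ← tabulate fun i => tabulate fun j => do
    let z ← Timed.mul ξ (CPos i j)
    let w ← Timed.neg z
    Timed.exp w
  pure ⟨rPos, cPos, K, if isSmall then eSmall else e⟩

/-- Extension by zero of a matrix on the positive entries. -/
def extend {m n : ℕ} (r : Fin m → ℝ) (c : Fin n → ℝ) (X : Pos r → Pos c → ℝ) :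
    Timed (Fin m → Fin n → ℝ) :=
  tabulate fun i => tabulate fun j =>
    pure (if h : 0 < r i ∧ 0 < c j then X ⟨i, h.1⟩ ⟨j, h.2⟩ else 0)

/-- `Round` followed by the extension by zero. -/
def finish {m n : ℕ} (r : Fin m → ℝ) (c : Fin n → ℝ) (D : Restricted r c)
    (X : Pos r → Pos c → ℝ) : Timed (Fin m → Fin n → ℝ) := do
  let Y ← round X D.rPos D.cPos
  extend r c Y

/-- `ApproxOT(r, c, C, ξ, ε)` terminates, returns `X`, and takes `T` steps. -/
def ApproxOTRuns {m n : ℕ} (r : Fin m → ℝ) (c : Fin n → ℝ) (C : Fin m → Fin n → ℝ) (ξ ε : ℝ)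
    (X : Fin m → Fin n → ℝ) (T : ℕ) : Prop :=
  ∃ (X' : Pos r → Pos c → ℝ) (t : ℕ),
    SinkhornRuns (prepare r c C ξ ε).val.K (prepare r c C ξ ε).val.rPos
      (prepare r c C ξ ε).val.cPos (prepare r c C ξ ε).val.ε' X' t ∧
    X = (finish r c (prepare r c C ξ ε).val X').val ∧
    T = (prepare r c C ξ ε).cost + t + (finish r c (prepare r c C ξ ε).val X').cost

end EntropicOT

end

noncomputable section

namespace EntropicOT

/-! ### A Pinsker-type inequality -/

/-! Up to normalisation, every matrix Sinkhorn produces is a scaling diag(e^u) K diag(e^v), so its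
logarithm is log K plus a row potential and a column potential. Write M = ξ‖C‖_∞ and J = M - log b.
Three facts carry the proof.

Optimality: potentials have the same integral against all couplings. Hence, if a coupling Y is a
scaling, the objective of any other coupling exceeds that of Y by its relative entropy with respect
to Y, divided by ξ (`objective_sub_of_isScaling`), and Y is the only minimiser. Such a Y exists by
compactness, because Sinkhorn produces scalings with bounded potentials and arbitrarily small
marginal error (`exists_isScaling_mem_couplings`).

Stability: prescribed row or column sums confine the matching potential to oscillation J. The
symmetrised relative entropy of two scalings pairs differences of marginals with differences of
potentials, so with a Pinsker inequality the squared distance is at most 2J times the marginal error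
(`sq_norm1_sub_le_of_isScaling`). The tolerance ε²/(8J) makes this (ε/2)²; rounding and
normalisation use the other ε/2 (`norm1_round_sub_le`).

Speed: from iterate 2 on, each pass lowers the relative entropy of the product coupling with respect
to the iterate by at least a quarter of the squared marginal error. At iterate 2 this entropy is at
most 2M, so the squared errors sum to at most 8M (`sum_sq_marginalError_le`). About 8M/ε'² passes of
cost O(mn) suffice, which gives the bound even without logarithmic factors in mn. -/

theorem sq_sqrt_sub_sqrt_le {p q : ℝ} (hp : 0 ≤ p) (hq : 0 < q) :
    (√p - √q) ^ 2 ≤ p * (Real.log p - Real.log q) - p + q := by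
  rcases hp.eq_or_lt with rfl | hp
  · simp [Real.sq_sqrt hq.le]
  have hsp := Real.sqrt_pos.2 hp
  have hsq := Real.sqrt_pos.2 hq
  -- The bound log x ≥ 1 - 1/x is used at √p/√q instead of p/q: multiplied by 2p it yields exactly
  -- the square of the difference of roots.
  have h1 := Real.one_sub_inv_le_log_of_pos (div_pos hsp hsq)
  rw [Real.log_div hsp.ne' hsq.ne', Real.log_sqrt hp.le, Real.log_sqrt hq.le, inv_div] at h1
  have h2 : p * (1 - √q / √p) = p - √p * √q := by
    have : p = √p * √p := (Real.mul_self_sqrt hp.le).symm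
    field_simp
    nlinarith [Real.sq_sqrt hp.le]
  nlinarith [mul_le_mul_of_nonneg_left h1 hp.le, Real.sq_sqrt hp.le, Real.sq_sqrt hq.le]

/-- Cauchy–Schwarz for p - q = (√p - √q)(√p + √q); the squares of the second factor sum to at most
4. The sharp Pinsker constant 2 is not needed. -/
theorem sq_sum_abs_sub_le {α : Type*} [Fintype α] {p q : α → ℝ} (hp : ∀ a, 0 ≤ p a)
    (hq : ∀ a, 0 < q a) (hp1 : ∑ a, p a = 1) (hq1 : ∑ a, q a = 1) :
    (∑ a, |p a - q a|) ^ 2 ≤ 4 * ∑ a, p a * (Real.log (p a) - Real.log (q a)) := by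
  have h1 : ∀ a, |p a - q a| = |√(p a) - √(q a)| * (√(p a) + √(q a)) := fun a => by
    rw [← abs_of_nonneg (add_nonneg (Real.sqrt_nonneg (p a)) (Real.sqrt_nonneg (q a))), ← abs_mul]
    congr 1
    nlinarith [Real.sq_sqrt (hp a), Real.sq_sqrt (hq a).le]
  have h2 : ∑ a, |√(p a) - √(q a)| ^ 2 ≤ ∑ a, p a * (Real.log (p a) - Real.log (q a)) := by
    have : ∑ a, |√(p a) - √(q a)| ^ 2
        ≤ ∑ a, (p a * (Real.log (p a) - Real.log (q a)) - p a + q a) :=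
      Finset.sum_le_sum fun a _ => by
        rw [sq_abs]
        exact sq_sqrt_sub_sqrt_le (hp a) (hq a)
    rw [Finset.sum_add_distrib, Finset.sum_sub_distrib, hp1, hq1] at this
    linarith
  have h3 : ∑ a, (√(p a) + √(q a)) ^ 2 ≤ 4 := by
    have : ∑ a, (√(p a) + √(q a)) ^ 2 ≤ ∑ a, (2 * p a + 2 * q a) :=
      Finset.sum_le_sum fun a _ => by
        nlinarith [Real.sq_sqrt (hp a), Real.sq_sqrt (hq a).le, sq_nonneg (√(p a) - √(q a))]
    rw [Finset.sum_add_distrib, ← Finset.mul_sum, ← Finset.mul_sum, hp1, hq1] at this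
    linarith
  have h4 := Finset.sum_mul_sq_le_sq_mul_sq Finset.univ (fun a => |√(p a) - √(q a)|)
    (fun a => √(p a) + √(q a))
  have h5 : 0 ≤ ∑ a, |√(p a) - √(q a)| ^ 2 := Finset.sum_nonneg fun a _ => sq_nonneg _
  simp_rw [h1]
  nlinarith

section

variable {ι κ : Type} [Fintype ι] [Fintype κ]

theorem sq_norm1_sub_le {X Y : ι → κ → ℝ} (hX : ∀ i j, 0 ≤ X i j) (hY : ∀ i j, 0 < Y i j)
    (hX1 : ∑ i, ∑ j, X i j = 1) (hY1 : ∑ i, ∑ j, Y i j = 1) :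
    norm1 (fun i j => X i j - Y i j) ^ 2
      ≤ 4 * ∑ i, ∑ j, X i j * (Real.log (X i j) - Real.log (Y i j)) := by
  have h := sq_sum_abs_sub_le (α := ι × κ) (p := fun a => X a.1 a.2) (q := fun a => Y a.1 a.2)
    (fun a => hX a.1 a.2) (fun a => hY a.1 a.2)
    (by rw [Fintype.sum_prod_type]; exact hX1) (by rw [Fintype.sum_prod_type]; exact hY1)
  rw [Fintype.sum_prod_type, Fintype.sum_prod_type] at h
  exact h

theorem norm1_sub_le (X Y Z : ι → κ → ℝ) :
    norm1 (fun i j => X i j - Z i j)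
      ≤ norm1 (fun i j => X i j - Y i j) + norm1 (fun i j => Y i j - Z i j) := by
  simp only [norm1, ← Finset.sum_add_distrib]
  exact Finset.sum_le_sum fun i _ => Finset.sum_le_sum fun j _ => abs_sub_le _ _ _

theorem norm1_sub_comm (X Y : ι → κ → ℝ) :
    norm1 (fun i j => X i j - Y i j) = norm1 (fun i j => Y i j - X i j) := by
  simp only [norm1, abs_sub_comm]

/-- A sum of potentials sees only the marginals of `X`; both optimality and stability rest on this.
-/
theorem sum_mul_add_potentials (X : ι → κ → ℝ) (u : ι → ℝ) (v : κ → ℝ) :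
    ∑ i, ∑ j, X i j * (u i + v j) = ∑ i, (∑ j, X i j) * u i + ∑ j, (∑ i, X i j) * v j := by
  simp_rw [mul_add, Finset.sum_add_distrib, Finset.sum_mul]
  congr 1
  exact Finset.sum_comm

/-- Because `d` has total zero, `a` may be centred at its midrange, after which it is bounded by `J`
in absolute value. -/
theorem sum_mul_le_of_osc_le {d a : ι → ℝ} {J : ℝ} (hd : ∑ i, d i = 0)
    (ha : ∀ i i', a i - a i' ≤ 2 * J) : ∑ i, d i * a i ≤ J * ∑ i, |d i| := by
  rcases isEmpty_or_nonempty ι with h | h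
  · simp
  obtain ⟨x, hx⟩ := Finite.exists_max a
  obtain ⟨y, hy⟩ := Finite.exists_min a
  have h1 : ∑ i, d i * a i = ∑ i, d i * (a i - (a x + a y) / 2) := by
    simp_rw [mul_sub, Finset.sum_sub_distrib, ← Finset.sum_mul, hd]
    simp
  rw [h1, Finset.mul_sum]
  refine Finset.sum_le_sum fun i _ => ?_
  have h2 : |a i - (a x + a y) / 2| ≤ J := by
    rw [abs_le]
    constructor <;> linarith [hx i, hy i, ha x y]
  calc d i * (a i - (a x + a y) / 2) ≤ |d i * (a i - (a x + a y) / 2)| := le_abs_self _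
    _ = |d i| * |a i - (a x + a y) / 2| := abs_mul _ _
    _ ≤ |d i| * J := mul_le_mul_of_nonneg_left h2 (abs_nonneg _)
    _ = J * |d i| := mul_comm _ _

end

/-! ### Diagonal scalings -/

section

variable {ι κ : Type} {K : ι → κ → ℝ} {u : ι → ℝ} {v : κ → ℝ} {X : ι → κ → ℝ} {r : ι → ℝ}
  {c : κ → ℝ} {M b : ℝ}

/-- `X = diag(e^u) K diag(e^v)`. -/
def IsScaling (K : ι → κ → ℝ) (u : ι → ℝ) (v : κ → ℝ) (X : ι → κ → ℝ) : Prop :=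
  ∀ i j, X i j = Real.exp (u i) * K i j * Real.exp (v j)

/-- The entries of `x` differ by at most `J`. -/
def OscLe (x : ι → ℝ) (J : ℝ) : Prop := ∀ i i', x i - x i' ≤ J

theorem IsScaling.pos (h : IsScaling K u v X) (hK : ∀ i j, 0 < K i j) (i : ι) (j : κ) :
    0 < X i j := by
  rw [h i j]
  have := hK i j
  positivity

theorem IsScaling.log_eq (h : IsScaling K u v X) (hK : ∀ i j, 0 < K i j) (i : ι) (j : κ) :
    Real.log (X i j) = Real.log (K i j) + (u i + v j) := by
  rw [h i j, Real.log_mul (mul_pos (Real.exp_pos _) (hK i j)).ne' (Real.exp_pos _).ne',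
    Real.log_mul (Real.exp_pos _).ne' (hK i j).ne', Real.log_exp, Real.log_exp]
  ring

theorem IsScaling.transpose (h : IsScaling K u v X) :
    IsScaling (fun j i => K i j) v u (fun j i => X i j) := fun j i => by
  change X i j = _
  rw [h i j]
  ring

/-- Potentials of a scaling of `K` whose row sums are proportional to `r`. -/
theorem IsScaling.oscLe_left [Fintype κ] [Nonempty κ] (h : IsScaling K u v X)
    (hK : ∀ i j, Real.exp (-M) ≤ K i j) (hK1 : ∀ i j, K i j ≤ 1) (hb : 0 < b)
    (hbr : ∀ i, b ≤ r i) (hr1 : ∀ i, r i ≤ 1) {t : ℝ} (ht : 0 < t)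
    (hrow : ∀ i, ∑ j, X i j = t * r i) : OscLe u (M - Real.log b) := by
  intro i i'
  have hS : ∀ i, Real.exp (u i) * ∑ j, K i j * Real.exp (v j) = t * r i := fun i => by
    rw [← hrow i, Finset.mul_sum]
    exact Finset.sum_congr rfl fun j _ => by rw [h i j, mul_assoc]
  have hpos : ∀ i, 0 < ∑ j, K i j * Real.exp (v j) := fun i =>
    Finset.sum_pos (fun j _ => mul_pos ((Real.exp_pos _).trans_le (hK i j)) (Real.exp_pos _))
      Finset.univ_nonempty
  have hle : ∑ j, K i' j * Real.exp (v j) ≤ Real.exp M * ∑ j, K i j * Real.exp (v j) := by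
    rw [Finset.mul_sum]
    refine Finset.sum_le_sum fun j _ => ?_
    rw [← mul_assoc]
    refine mul_le_mul_of_nonneg_right ((hK1 i' j).trans ?_) (Real.exp_pos _).le
    calc (1 : ℝ) = Real.exp M * Real.exp (-M) := by rw [← Real.exp_add]; simp
      _ ≤ _ := mul_le_mul_of_nonneg_left (hK i j) (Real.exp_pos _).le
  -- The row equation expresses `u` through the row sums of K e^v, which agree up to a factor e^M,
  -- and through `r`, which lies in [b, 1]. The factor `t` cancels in differences.
  have hlog : ∀ i, u i = Real.log t + Real.log (r i) - Real.log (∑ j, K i j * Real.exp (v j)) :=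
    fun i => by
      have := congrArg Real.log (hS i)
      rw [Real.log_mul (Real.exp_pos _).ne' (hpos i).ne', Real.log_exp,
        Real.log_mul ht.ne' (hb.trans_le (hbr i)).ne'] at this
      linarith
  have h1 := Real.log_le_log (hpos i') hle
  rw [Real.log_mul (Real.exp_pos _).ne' (hpos i).ne', Real.log_exp] at h1
  have h2 := Real.log_le_log hb (hbr i')
  have h3 := Real.log_nonpos (hb.le.trans (hbr i)) (hr1 i)
  rw [hlog i, hlog i']
  linarith

theorem IsScaling.oscLe_right [Fintype ι] [Nonempty ι] (h : IsScaling K u v X)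
    (hK : ∀ i j, Real.exp (-M) ≤ K i j) (hK1 : ∀ i j, K i j ≤ 1) (hb : 0 < b)
    (hbc : ∀ j, b ≤ c j) (hc1 : ∀ j, c j ≤ 1)
    (hcol : ∀ j, ∑ i, X i j = c j) : OscLe v (M - Real.log b) :=
  h.transpose.oscLe_left (fun j i => hK i j) (fun j i => hK1 i j) hb hbc hc1 one_pos
    (fun j => by rw [one_mul]; exact hcol j)

end

section

variable {ι κ : Type} [Fintype ι] [Fintype κ]

/-- `‖X 1 - r‖₁ + ‖Xᵀ 1 - c‖₁`. -/
def marginalError (r : ι → ℝ) (c : κ → ℝ) (X : ι → κ → ℝ) : ℝ :=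
  ∑ i, |∑ j, X i j - r i| + ∑ j, |∑ i, X i j - c j|

theorem marginalError_nonneg (r : ι → ℝ) (c : κ → ℝ) (X : ι → κ → ℝ) :
    0 ≤ marginalError r c X :=
  add_nonneg (Finset.sum_nonneg fun _ _ => abs_nonneg _) (Finset.sum_nonneg fun _ _ => abs_nonneg _)

variable {K : ι → κ → ℝ} {u u' : ι → ℝ} {v v' : κ → ℝ} {X Y : ι → κ → ℝ} {r : ι → ℝ} {c : κ → ℝ}
  {J M : ℝ}

/-- Two scalings of the same matrix differ by no more than their marginals do. -/
theorem sq_norm1_sub_le_of_isScaling (hK : ∀ i j, 0 < K i j) (hX : IsScaling K u v X)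
    (hY : IsScaling K u' v' Y) (hu : OscLe u J) (hv : OscLe v J) (hu' : OscLe u' J)
    (hv' : OscLe v' J) (hr : ∀ i, ∑ j, X i j = r i) (hc : ∀ j, ∑ i, X i j = c j)
    (hX1 : ∑ i, ∑ j, X i j = 1) (hY1 : ∑ i, ∑ j, Y i j = 1) :
    norm1 (fun i j => Y i j - X i j) ^ 2 ≤ 2 * J * marginalError r c Y := by
  have h1 := sq_norm1_sub_le (fun i j => (hX.pos hK i j).le) (hY.pos hK) hX1 hY1
  have h2 := sq_norm1_sub_le (fun i j => (hY.pos hK i j).le) (hX.pos hK) hY1 hX1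
  rw [norm1_sub_comm X Y] at h1
  -- In the sum of both relative entropies log K cancels, and `Y - X` is paired with differences of
  -- potentials only. Those differences oscillate by at most 2J.
  have h3 : ∑ i, ∑ j, X i j * (Real.log (X i j) - Real.log (Y i j))
      + ∑ i, ∑ j, Y i j * (Real.log (Y i j) - Real.log (X i j))
      = ∑ i, ∑ j, (Y i j - X i j) * ((u' i - u i) + (v' j - v j)) := by
    simp_rw [← Finset.sum_add_distrib]
    refine Finset.sum_congr rfl fun i _ => Finset.sum_congr rfl fun j _ => ?_
    rw [hX.log_eq hK, hY.log_eq hK]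
    ring
  rw [sum_mul_add_potentials] at h3
  simp_rw [Finset.sum_sub_distrib, hr, hc] at h3
  have hr1 : ∑ i, r i = 1 := by simp_rw [← hr]; exact hX1
  have hc1 : ∑ j, c j = 1 := by simp_rw [← hc]; rw [Finset.sum_comm]; exact hX1
  have h4 : ∑ i, (∑ j, Y i j - r i) * (u' i - u i) ≤ J * ∑ i, |∑ j, Y i j - r i| := by
    refine sum_mul_le_of_osc_le ?_ fun i i' => ?_
    · rw [Finset.sum_sub_distrib, hY1, hr1, sub_self]
    · linarith [hu i' i, hu' i i']
  have h5 : ∑ j, (∑ i, Y i j - c j) * (v' j - v j) ≤ J * ∑ j, |∑ i, Y i j - c j| := by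
    refine sum_mul_le_of_osc_le ?_ fun i i' => ?_
    · rw [Finset.sum_sub_distrib, Finset.sum_comm, hY1, hc1, sub_self]
    · linarith [hv i' i, hv' i i']
  unfold marginalError
  linarith

/-! ### The optimal coupling -/

/-- Since log Y = -ξC + u + v and the potentials integrate equally against `X` and `Y`, the cost
term can be traded for log Y, which leaves a relative entropy. -/
theorem objective_sub_of_isScaling {C : ι → κ → ℝ} {ξ : ℝ} (hξ : 0 < ξ)
    (hY : IsScaling (fun i j => Real.exp (-(ξ * C i j))) u v Y) (hYc : Y ∈ couplings r c)
    (hXc : X ∈ couplings r c) :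
    objective C ξ X - objective C ξ Y
      = 1 / ξ * ∑ i, ∑ j, X i j * (Real.log (X i j) - Real.log (Y i j)) := by
  have hlog : ∀ i j, Real.log (Y i j) = -(ξ * C i j) + (u i + v j) := fun i j => by
    rw [hY.log_eq (fun i j => Real.exp_pos _), Real.log_exp]
  have key : ∀ Z : ι → κ → ℝ, Z ∈ couplings r c →
      ∑ i, ∑ j, Z i j * Real.log (Y i j)
        = -(ξ * ∑ i, ∑ j, Z i j * C i j) + (∑ i, r i * u i + ∑ j, c j * v j) := by
    intro Z hZ
    have h1 := sum_mul_add_potentials Z u v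
    simp_rw [hZ.2.1, hZ.2.2] at h1
    rw [← h1, Finset.mul_sum, ← Finset.sum_neg_distrib, ← Finset.sum_add_distrib]
    refine Finset.sum_congr rfl fun i _ => ?_
    rw [Finset.mul_sum, ← Finset.sum_neg_distrib, ← Finset.sum_add_distrib]
    refine Finset.sum_congr rfl fun j _ => ?_
    rw [hlog]
    ring
  have hX := key X hXc
  have hY' := key Y hYc
  unfold objective entropy
  simp_rw [mul_sub, Finset.sum_sub_distrib]
  rw [hX, hY']
  field_simp
  ring

theorem sum_coupling (hX : X ∈ couplings r c) (hr : ∑ i, r i = 1) : ∑ i, ∑ j, X i j = 1 := by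
  simp_rw [hX.2.1]
  exact hr

theorem isOptimal_iff_of_isScaling {C : ι → κ → ℝ} {ξ : ℝ} (hξ : 0 < ξ)
    (hY : IsScaling (fun i j => Real.exp (-(ξ * C i j))) u v Y) (hYc : Y ∈ couplings r c)
    (hr : ∑ i, r i = 1) : IsOptimal r c C ξ X ↔ X = Y := by
  have key : ∀ Z ∈ couplings r c,
      norm1 (fun i j => Z i j - Y i j) ^ 2 ≤ 4 * (ξ * (objective C ξ Z - objective C ξ Y)) := by
    intro Z hZ
    rw [objective_sub_of_isScaling hξ hY hYc hZ, ← mul_assoc ξ, mul_one_div_cancel hξ.ne', one_mul]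
    exact sq_norm1_sub_le hZ.1 (hY.pos fun i j => Real.exp_pos _) (sum_coupling hZ hr)
      (sum_coupling hYc hr)
  constructor
  · rintro ⟨hX, hmin⟩
    have h1 := key X hX
    have h2 : objective C ξ X ≤ objective C ξ Y := hmin hYc
    have h3 : norm1 (fun i j => X i j - Y i j) = 0 := by
      have : norm1 (fun i j => X i j - Y i j) ^ 2 ≤ 0 := by nlinarith
      exact pow_eq_zero_iff two_ne_zero |>.1 (le_antisymm this (sq_nonneg _))
    funext i j
    have h4 := (Finset.sum_eq_zero_iff_of_nonneg fun i _ =>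
      Finset.sum_nonneg fun j _ => abs_nonneg _).1 h3 i (Finset.mem_univ i)
    have h5 := (Finset.sum_eq_zero_iff_of_nonneg fun j _ => abs_nonneg _).1 h4 j (Finset.mem_univ j)
    exact sub_eq_zero.1 (abs_eq_zero.1 h5)
  · rintro rfl
    refine ⟨hYc, fun Z hZ => ?_⟩
    have h1 := (sq_nonneg _).trans (key Z hZ)
    have h2 : 0 ≤ objective C ξ Z - objective C ξ X := by
      by_contra! h
      nlinarith [mul_pos_of_neg_of_neg h (neg_neg_of_pos hξ)]
    exact sub_nonneg.1 h2

/-- A scaling with the prescribed marginals exists if they can be approximated by scalings with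
bounded potentials. -/
theorem exists_isScaling_mem_couplings [Nonempty ι] [Nonempty κ]
    (hK : ∀ i j, Real.exp (-M) ≤ K i j) (hK1 : ∀ i j, K i j ≤ 1)
    (happrox : ∀ ε > 0, ∃ X u v, IsScaling K u v X ∧ OscLe u J ∧ OscLe v J ∧
      ∑ i, ∑ j, X i j = 1 ∧ marginalError r c X ≤ ε) :
    ∃ X u v, IsScaling K u v X ∧ X ∈ couplings r c := by
  have hKpos : ∀ i j, 0 < K i j := fun i j => (Real.exp_pos _).trans_le (hK i j)
  -- Bounded oscillation makes each entry at least e^{-(2J+M)} times any other; summing over all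
  -- entries of a matrix of mass 1 gives the lower bound `δ`.
  set δ : ℝ := Real.exp (-(2 * J + M)) / (Fintype.card ι * Fintype.card κ) with hδ
  have hcard : (0 : ℝ) < Fintype.card ι * Fintype.card κ := by
    have := Fintype.card_pos (α := ι)
    have := Fintype.card_pos (α := κ)
    positivity
  have hδ0 : 0 < δ := div_pos (Real.exp_pos _) hcard
  -- For positive matrices the cross-ratio identity characterises scalings of `K` without mentioning
  -- potentials. It is a closed condition, and the bound `δ` keeps limits positive.
  let Z : Set (ι → κ → ℝ) :=
    {X | (∀ i j, X i j ∈ Set.Icc δ 1) ∧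
      ∀ i j i' j', X i j * X i' j' * (K i j' * K i' j) = X i j' * X i' j * (K i j * K i' j')}
  have hZc : IsCompact Z := by
    have h1 : IsCompact (Set.pi Set.univ fun _ : ι => Set.pi Set.univ fun _ : κ => Set.Icc δ 1) :=
      isCompact_univ_pi fun _ => isCompact_univ_pi fun _ => isCompact_Icc
    have h2 : IsClosed {X : ι → κ → ℝ | ∀ i j i' j',
        X i j * X i' j' * (K i j' * K i' j) = X i j' * X i' j * (K i j * K i' j')} := by
      simp only [Set.ofPred_forall]
      exact isClosed_iInter fun i => isClosed_iInter fun j => isClosed_iInter fun i' =>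
        isClosed_iInter fun j' => isClosed_eq (by fun_prop) (by fun_prop)
    convert h1.inter_right h2 using 1
    ext X
    exact ⟨fun h => ⟨fun i _ j _ => h.1 i j, h.2⟩, fun h => ⟨fun i j => h.1 i trivial j trivial,
      h.2⟩⟩
  have hmem : ∀ X u v, IsScaling K u v X → OscLe u J → OscLe v J → ∑ i, ∑ j, X i j = 1 →
      X ∈ Z := by
    intro X u v hX hu hv hX1
    have hpos := hX.pos hKpos
    refine ⟨fun i j => ⟨?_, ?_⟩, fun i j i' j' => ?_⟩
    · have h1 : ∀ i' j', Real.exp (-(2 * J + M)) * X i' j' ≤ X i j := fun i' j' => by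
        rw [hX i j, hX i' j']
        have h2 : Real.exp (-(2 * J + M)) * (Real.exp (u i') * K i' j' * Real.exp (v j'))
            ≤ Real.exp (u i + -M + v j) := by
          calc _ ≤ Real.exp (-(2 * J + M)) * (Real.exp (u i') * 1 * Real.exp (v j')) := by
                gcongr
                exact hK1 i' j'
            _ = Real.exp (-(2 * J + M) + u i' + v j') := by
                rw [Real.exp_add, Real.exp_add]; ring
            _ ≤ _ := Real.exp_le_exp.2 (by linarith [hu i' i, hv j' j])
        refine h2.trans ?_
        rw [Real.exp_add, Real.exp_add]
        gcongr
        exact hK i j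
      have h2 : ∑ i' : ι, ∑ j' : κ, Real.exp (-(2 * J + M)) * X i' j' ≤ ∑ _i : ι, ∑ _j : κ, X i j :=
        Finset.sum_le_sum fun i' _ => Finset.sum_le_sum fun j' _ => h1 i' j'
      simp_rw [← Finset.mul_sum, hX1, Finset.sum_const, Finset.card_univ, nsmul_eq_mul] at h2
      rw [hδ, div_le_iff₀ hcard]
      linarith
    · calc X i j ≤ ∑ j, X i j :=
            Finset.single_le_sum (fun j _ => (hpos i j).le) (Finset.mem_univ j)
        _ ≤ ∑ i, ∑ j, X i j := Finset.single_le_sum (f := fun i => ∑ j, X i j)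
            (fun i _ => Finset.sum_nonneg fun j _ => (hpos i j).le) (Finset.mem_univ i)
        _ = 1 := hX1
    · rw [hX i j, hX i' j', hX i j', hX i' j]
      ring
  obtain ⟨X₁, u₁, v₁, h1, h2, h3, h4, -⟩ := happrox 1 one_pos
  obtain ⟨X, hXZ, hmin⟩ := hZc.exists_isMinOn ⟨X₁, hmem X₁ u₁ v₁ h1 h2 h3 h4⟩
    (f := marginalError r c) (Continuous.continuousOn (by unfold marginalError; fun_prop))
  have hzero : marginalError r c X = 0 := by
    refine le_antisymm (le_of_forall_pos_le_add fun ε hε => ?_) (marginalError_nonneg _ _ _)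
    obtain ⟨X', u, v, h1, h2, h3, h4, h5⟩ := happrox ε hε
    rw [zero_add]
    exact (hmin (hmem X' u v h1 h2 h3 h4)).trans h5
  have hpos : ∀ i j, 0 < X i j := fun i j => hδ0.trans_le (hXZ.1 i j).1
  obtain ⟨i₀⟩ := ‹Nonempty ι›
  obtain ⟨j₀⟩ := ‹Nonempty κ›
  -- Potentials are read off from the base column `j₀` and the base row `i₀`; the cross-ratio
  -- identity extends this to all entries.
  refine ⟨X, fun i => Real.log (X i j₀ / K i j₀),
    fun j => Real.log (X i₀ j / K i₀ j * (K i₀ j₀ / X i₀ j₀)), fun i j => ?_,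
    fun i j => (hpos i j).le, fun i => ?_, fun j => ?_⟩
  · rw [Real.exp_log (div_pos (hpos _ _) (hKpos _ _)), Real.exp_log (mul_pos
      (div_pos (hpos _ _) (hKpos _ _)) (div_pos (hKpos _ _) (hpos _ _)))]
    have := hXZ.2 i j i₀ j₀
    have a1 := (hpos i₀ j₀).ne'
    have a2 := (hKpos i j₀).ne'
    have a3 := (hKpos i₀ j).ne'
    field_simp
    linarith
  · have h5 := (add_eq_zero_iff_of_nonneg (Finset.sum_nonneg fun _ _ => abs_nonneg _)
      (Finset.sum_nonneg fun _ _ => abs_nonneg _)).1 hzero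
    exact sub_eq_zero.1 (abs_eq_zero.1 ((Finset.sum_eq_zero_iff_of_nonneg fun j _ =>
      abs_nonneg _).1 h5.1 i (Finset.mem_univ i)))
  · have h5 := (add_eq_zero_iff_of_nonneg (Finset.sum_nonneg fun _ _ => abs_nonneg _)
      (Finset.sum_nonneg fun _ _ => abs_nonneg _)).1 hzero
    exact sub_eq_zero.1 (abs_eq_zero.1 ((Finset.sum_eq_zero_iff_of_nonneg fun j _ =>
      abs_nonneg _).1 h5.2 j (Finset.mem_univ j)))

end

/-! ### Running times of loops -/

theorem Timed.pure_cost {α : Type} (a : α) : (pure a : Timed α).cost = 0 := rfl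

theorem Timed.bind_val {α β : Type} (x : Timed α) (f : α → Timed β) :
    (x >>= f).val = (f x.val).val := rfl

theorem Timed.bind_cost {α β : Type} (x : Timed α) (f : α → Timed β) :
    (x >>= f).cost = x.cost + (f x.val).cost := rfl

theorem Timed.exists_whileRuns {σ : Type} {test : σ → Timed Bool} {body : σ → Timed σ} {B : ℕ}
    (hB : ∀ s, (test s).cost + (body s).cost ≤ B) (k : ℕ) (s : σ)
    (htrue : ∀ i < k, (test ((fun s => (body s).val)^[i] s)).val = true)
    (hfalse : (test ((fun s => (body s).val)^[k] s)).val = false) :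
    ∃ t, Timed.WhileRuns test body s ((fun s => (body s).val)^[k] s) t ∧ t ≤ (k + 1) * B := by
  induction k generalizing s with
  | zero => exact ⟨_, Timed.WhileRuns.finished s hfalse, by linarith [hB s]⟩
  | succ k ih =>
    obtain ⟨t, ht, hle⟩ := ih (body s).val (fun i hi => htrue (i + 1) (by omega)) hfalse
    exact ⟨_, Timed.WhileRuns.step s _ t (htrue 0 (by omega)) ht, by linarith [hB s]⟩

/-! ### The effect of a single Sinkhorn update -/

section

variable {ι κ : Type} {K : ι → κ → ℝ} {u : ι → ℝ} {v : κ → ℝ} {X Y : ι → κ → ℝ} {r : ι → ℝ}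
  {c : κ → ℝ} {t : ℝ}

/-- The effect of an update of the row potential. -/
theorem eq_of_row_update [Fintype κ]
    (hX : ∀ i j, t * X i j = Real.exp (u i) * K i j * Real.exp (v j))
    (hr : ∀ i, 0 < r i) (hsum : ∀ i, 0 < ∑ j, X i j)
    (hY : IsScaling K (fun i => u i + Real.log (r i / ∑ j, X i j)) v Y) (i : ι) (j : κ) :
    Y i j = t * (r i / ∑ j, X i j) * X i j := by
  rw [hY i j, Real.exp_add, Real.exp_log (div_pos (hr i) (hsum i))]
  linear_combination (-(r i / ∑ j, X i j)) * hX i j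

/-- The factor `t` is there for the first pass, where it equals the mass of `K`; later row updates
use t = 1. -/
theorem row_sum_of_row_update [Fintype κ]
    (hsum : ∀ i, 0 < ∑ j, X i j)
    (hY : ∀ i j, Y i j = t * (r i / ∑ j, X i j) * X i j) (i : ι) : ∑ j, Y i j = t * r i := by
  simp_rw [hY i, ← Finset.mul_sum]
  have := (hsum i).ne'
  field_simp

/-- The effect of an update of the column potential. -/
theorem col_update [Fintype ι] [Nonempty ι] (hX : IsScaling K u v X) (hpos : ∀ i j, 0 < X i j)
    (hc : ∀ j, 0 < c j) (hY : IsScaling K u (fun j => v j + Real.log (c j / ∑ i, X i j)) Y) :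
    (∀ i j, Y i j = c j / (∑ i, X i j) * X i j) ∧ ∀ j, ∑ i, Y i j = c j := by
  have hsum : ∀ j, 0 < ∑ i, X i j := fun j =>
    Finset.sum_pos (fun i _ => hpos i j) Finset.univ_nonempty
  have h : ∀ i j, Y i j = c j / (∑ i, X i j) * X i j := fun i j => by
    rw [hY i j, Real.exp_add, Real.exp_log (div_pos (hc j) (hsum j)), hX i j]
    ring
  refine ⟨h, fun j => ?_⟩
  simp_rw [h, ← Finset.mul_sum]
  exact div_mul_cancel₀ _ (hsum j).ne'

end

/-! ### Values and costs of the steps of Sinkhorn -/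

section

variable {ι κ : Type} [Fintype ι] [Fintype κ]

theorem sinkhornTest_val (r : ι → ℝ) (c : κ → ℝ) (ε' : ℝ) (s : SinkhornState ι κ) :
    (sinkhornTest r c ε' s).val = decide (ε' < marginalError r c s.X) := rfl

theorem sinkhornBody_val_of_even (K : ι → κ → ℝ) (r : ι → ℝ) (c : κ → ℝ) (s : SinkhornState ι κ)
    (hs : s.k % 2 = 0) :
    (sinkhornBody K r c s).val = ⟨s.k + 1,
      fun i j => Real.exp (s.u i + Real.log (r i / ∑ j, s.X i j)) * K i j * Real.exp (s.v j),
      fun i => s.u i + Real.log (r i / ∑ j, s.X i j), s.v⟩ := by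
  have h : (s.k + 1) % 2 = 1 := by omega
  simp only [sinkhornBody, Timed.bind_val, Timed.natSucc, Timed.natOdd, h, decide_true, if_true]
  rfl

theorem sinkhornBody_val_of_odd (K : ι → κ → ℝ) (r : ι → ℝ) (c : κ → ℝ) (s : SinkhornState ι κ)
    (hs : s.k % 2 = 1) :
    (sinkhornBody K r c s).val = ⟨s.k + 1,
      fun i j => Real.exp (s.u i) * K i j * Real.exp (s.v j + Real.log (c j / ∑ i, s.X i j)),
      s.u, fun j => s.v j + Real.log (c j / ∑ i, s.X i j)⟩ := by
  have h : ¬ (s.k + 1) % 2 = 1 := by omega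
  simp only [sinkhornBody, Timed.bind_val, Timed.natSucc, Timed.natOdd, h, decide_false,
      Bool.false_eq_true,
    if_false]
  rfl

theorem sinkhornInit_cost_le [Nonempty ι] [Nonempty κ] (K : ι → κ → ℝ) :
    (sinkhornInit K).cost ≤ 9 * (Fintype.card ι * Fintype.card κ) := by
  have h1 := Nat.one_le_iff_ne_zero.2 (Fintype.card_ne_zero (α := ι))
  have h2 := Nat.one_le_iff_ne_zero.2 (Fintype.card_ne_zero (α := κ))
  simp only [sinkhornInit, Timed.bind_cost, Timed.pure_cost, Timed.sum, Timed.tabulate, Timed.abs,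
    Timed.div, Finset.sum_const, Finset.card_univ, smul_eq_mul]
  nlinarith

theorem sinkhornTest_cost_le [Nonempty ι] [Nonempty κ] (r : ι → ℝ) (c : κ → ℝ) (ε' : ℝ)
    (s : SinkhornState ι κ) :
    (sinkhornTest r c ε' s).cost ≤ 14 * (Fintype.card ι * Fintype.card κ) := by
  have h1 := Nat.one_le_iff_ne_zero.2 (Fintype.card_ne_zero (α := ι))
  have h2 := Nat.one_le_iff_ne_zero.2 (Fintype.card_ne_zero (α := κ))
  simp only [sinkhornTest, rowSums, colSums, vecSub, vecNorm1, Timed.bind_cost, Timed.pure_cost,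
    Timed.sum, Timed.tabulate, Timed.abs, Timed.add, Timed.lt, Timed.sub, Finset.sum_const,
    Finset.card_univ, smul_eq_mul]
  nlinarith

theorem sinkhornBody_cost_le [Nonempty ι] [Nonempty κ] (K : ι → κ → ℝ) (r : ι → ℝ) (c : κ → ℝ)
    (s : SinkhornState ι κ) :
    (sinkhornBody K r c s).cost ≤ 17 * (Fintype.card ι * Fintype.card κ) := by
  have h1 := Nat.one_le_iff_ne_zero.2 (Fintype.card_ne_zero (α := ι))
  have h2 := Nat.one_le_iff_ne_zero.2 (Fintype.card_ne_zero (α := κ))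
  simp only [sinkhornBody, Timed.bind_cost]
  split <;>
  · simp only [rowSums, colSums, logRatio, vecAdd, scaled, Timed.natSucc, Timed.natOdd,
      Timed.bind_cost,
      Timed.pure_cost, Timed.sum, Timed.tabulate, Timed.add, Timed.div, Timed.log, Timed.exp,
      Timed.mul,
      Finset.sum_const, Finset.card_univ, smul_eq_mul]
    nlinarith

/-! ### The iterates of `Sinkhorn` -/

/-- The hypotheses on the kernel and the marginals under which `Sinkhorn` is analysed. -/
structure IsKernelBound (K : ι → κ → ℝ) (r : ι → ℝ) (c : κ → ℝ) (M b : ℝ) : Prop where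
  exp_le : ∀ i j, Real.exp (-M) ≤ K i j
  le_one : ∀ i j, K i j ≤ 1
  pos : 0 < b
  le_row : ∀ i, b ≤ r i
  le_col : ∀ j, b ≤ c j
  sum_row : ∑ i, r i = 1
  sum_col : ∑ j, c j = 1

/-- The relative entropy of the product coupling with respect to `X`. -/
def productGap (r : ι → ℝ) (c : κ → ℝ) (X : ι → κ → ℝ) : ℝ :=
  ∑ i, ∑ j, r i * c j * (Real.log (r i * c j) - Real.log (X i j))

variable {K X Y : ι → κ → ℝ} {r : ι → ℝ} {c : κ → ℝ} {M b : ℝ}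

theorem marginalError_transpose :
    marginalError c r (fun j i => X i j) = marginalError r c X := add_comm _ _

theorem productGap_transpose : productGap c r (fun j i => X i j) = productGap r c X := by
  unfold productGap
  rw [Finset.sum_comm]
  simp_rw [mul_comm (c _)]

theorem IsKernelBound.transpose (h : IsKernelBound K r c M b) :
    IsKernelBound (fun j i => K i j) c r M b where
  exp_le j i := h.exp_le i j
  le_one j i := h.le_one i j
  pos := h.pos
  le_row := h.le_col
  le_col := h.le_row
  sum_row := h.sum_col
  sum_col := h.sum_row

theorem IsKernelBound.kernel_pos (h : IsKernelBound K r c M b) (i : ι) (j : κ) : 0 < K i j :=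
  (Real.exp_pos _).trans_le (h.exp_le i j)

theorem IsKernelBound.row_pos (h : IsKernelBound K r c M b) (i : ι) : 0 < r i :=
  h.pos.trans_le (h.le_row i)

theorem IsKernelBound.row_le_one (h : IsKernelBound K r c M b) (i : ι) : r i ≤ 1 := by
  rw [← h.sum_row]
  exact Finset.single_le_sum (fun i _ => (h.row_pos i).le) (Finset.mem_univ i)

theorem IsKernelBound.col_pos (h : IsKernelBound K r c M b) (j : κ) : 0 < c j :=
  h.transpose.row_pos j

theorem IsKernelBound.col_le_one (h : IsKernelBound K r c M b) (j : κ) : c j ≤ 1 :=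
  h.transpose.row_le_one j

theorem IsKernelBound.bound_nonneg [Nonempty ι] [Nonempty κ] (h : IsKernelBound K r c M b) :
    0 ≤ M := by
  obtain ⟨i⟩ := ‹Nonempty ι›
  obtain ⟨j⟩ := ‹Nonempty κ›
  have := Real.exp_le_one_iff.1 ((h.exp_le i j).trans (h.le_one i j))
  linarith

theorem IsKernelBound.log_nonpos [Nonempty ι] (h : IsKernelBound K r c M b) : Real.log b ≤ 0 := by
  obtain ⟨i⟩ := ‹Nonempty ι›
  exact Real.log_nonpos h.pos.le ((h.le_row i).trans (h.row_le_one i))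

theorem IsKernelBound.osc_nonneg [Nonempty ι] [Nonempty κ] (h : IsKernelBound K r c M b) :
    0 ≤ M - Real.log b := by
  linarith [h.bound_nonneg, h.log_nonpos]

theorem productGap_nonneg (h : IsKernelBound K r c M b) (hX : ∀ i j, 0 < X i j)
    (hX1 : ∑ i, ∑ j, X i j = 1) : 0 ≤ productGap r c X := by
  have h1 := sq_norm1_sub_le (X := fun i j => r i * c j)
    (fun i j => (mul_pos (h.row_pos i) (h.col_pos j)).le) hX
    (by simp_rw [← Finset.mul_sum, h.sum_col, mul_one, h.sum_row]) hX1
  have h2 := (sq_nonneg _).trans h1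
  unfold productGap
  linarith

/-- The update adds log(r_i / row sum) to the logarithms in row i, and `c` has mass 1, so the gap
drops by exactly the relative entropy of `r` with respect to the row sums. The columns are already
exact, so Pinsker bounds the whole marginal error. -/
theorem sq_marginalError_le_of_row_update [Nonempty κ] (h : IsKernelBound K r c M b)
    (hX : ∀ i j, 0 < X i j) (hcol : ∀ j, ∑ i, X i j = c j)
    (hY : ∀ i j, Y i j = r i / (∑ j, X i j) * X i j) :
    marginalError r c X ^ 2 ≤ 4 * (productGap r c X - productGap r c Y) := by
  have hsum : ∀ i, 0 < ∑ j, X i j := fun i =>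
    Finset.sum_pos (fun j _ => hX i j) Finset.univ_nonempty
  have h1 := sq_sum_abs_sub_le (fun i => (h.row_pos i).le) hsum h.sum_row
    (by rw [Finset.sum_comm]; simp_rw [hcol]; exact h.sum_col)
  have h2 : productGap r c X - productGap r c Y
      = ∑ i, r i * (Real.log (r i) - Real.log (∑ j, X i j)) := by
    unfold productGap
    simp_rw [← Finset.sum_sub_distrib]
    refine Finset.sum_congr rfl fun i _ => ?_
    have : ∀ j, r i * c j * (Real.log (r i * c j) - Real.log (X i j))
        - r i * c j * (Real.log (r i * c j) - Real.log (Y i j))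
        = c j * (r i * (Real.log (r i) - Real.log (∑ j, X i j))) := fun j => by
      rw [hY, Real.log_mul (div_pos (h.row_pos i) (hsum i)).ne' (hX i j).ne',
        Real.log_div (h.row_pos i).ne' (hsum i).ne']
      ring
    simp_rw [this, ← Finset.sum_mul, h.sum_col, one_mul]
  have h3 : marginalError r c X = ∑ i, |r i - ∑ j, X i j| := by
    unfold marginalError
    simp_rw [hcol, sub_self, abs_zero, Finset.sum_const_zero, add_zero]
    exact Finset.sum_congr rfl fun i _ => abs_sub_comm _ _
  rw [h2, h3]
  exact h1

/-- The state of `Sinkhorn` after `k` passes through the loop. -/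
def sinkhornIterate (K : ι → κ → ℝ) (r : ι → ℝ) (c : κ → ℝ) (k : ℕ) : SinkhornState ι κ :=
  (fun s => (sinkhornBody K r c s).val)^[k] (sinkhornInit K).val

theorem sinkhornIterate_succ (k : ℕ) :
    sinkhornIterate K r c (k + 1) = (sinkhornBody K r c (sinkhornIterate K r c k)).val :=
  Function.iterate_succ_apply' _ _ _

theorem sinkhornIterate_zero_X (h : IsKernelBound K r c M b) (i : ι) (j : κ) :
    (sinkhornIterate K r c 0).X i j = K i j / ∑ i, ∑ j, K i j := by
  change K i j / ∑ i, ∑ j, |K i j| = _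
  simp_rw [abs_of_pos (h.kernel_pos _ _)]

/-- What holds in every state of `Sinkhorn` after the second pass through the loop. -/
structure IsRegularState (K : ι → κ → ℝ) (r : ι → ℝ) (c : κ → ℝ) (J : ℝ)
    (s : SinkhornState ι κ) : Prop where
  isScaling : IsScaling K s.u s.v s.X
  osc_left : OscLe s.u J
  osc_right : OscLe s.v J
  row_sum : s.k % 2 = 1 → ∀ i, ∑ j, s.X i j = r i
  col_sum : s.k % 2 = 0 → ∀ j, ∑ i, s.X i j = c j

theorem IsRegularState.sum_eq_one {J : ℝ} {s : SinkhornState ι κ} (hs : IsRegularState K r c J s)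
    (h : IsKernelBound K r c M b) : ∑ i, ∑ j, s.X i j = 1 := by
  rcases Nat.mod_two_eq_zero_or_one s.k with hk | hk
  · rw [Finset.sum_comm]
    simp_rw [hs.col_sum hk]
    exact h.sum_col
  · simp_rw [hs.row_sum hk]
    exact h.sum_row

variable [Nonempty ι] [Nonempty κ]

/-- The potential that is not updated keeps its oscillation bound, and the new one is controlled by
the sums just corrected. Column passes reduce to row passes by transposition. -/
theorem IsRegularState.next (h : IsKernelBound K r c M b) {s : SinkhornState ι κ}
    (hs : IsRegularState K r c (M - Real.log b) s) :
    IsRegularState K r c (M - Real.log b) (sinkhornBody K r c s).val ∧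
      marginalError r c s.X ^ 2
        ≤ 4 * (productGap r c s.X - productGap r c (sinkhornBody K r c s).val.X) := by
  have hpos := hs.isScaling.pos h.kernel_pos
  rcases Nat.mod_two_eq_zero_or_one s.k with hk | hk
  · rw [sinkhornBody_val_of_even K r c s hk]
    have hsum : ∀ i, 0 < ∑ j, s.X i j := fun i =>
      Finset.sum_pos (fun j _ => hpos i j) Finset.univ_nonempty
    have hY := eq_of_row_update (t := 1) (fun i j => by rw [one_mul]; exact hs.isScaling i j)
      h.row_pos hsum (fun i j => rfl)
    have hrow := row_sum_of_row_update hsum hY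
    refine ⟨⟨fun i j => rfl, ?_, hs.osc_right, fun _ i => ?_, fun h0 => ?_⟩, ?_⟩
    · exact IsScaling.oscLe_left (fun i j => rfl) h.exp_le h.le_one h.pos h.le_row h.row_le_one
        one_pos hrow
    · rw [hrow i, one_mul]
    · simp only at h0
      omega
    · exact sq_marginalError_le_of_row_update h hpos (hs.col_sum hk)
        (fun i j => (hY i j).trans (by rw [one_mul]))
  · rw [sinkhornBody_val_of_odd K r c s hk]
    have hsc : IsScaling K s.u (fun j => s.v j + Real.log (c j / ∑ i, s.X i j)) (fun i j =>
        Real.exp (s.u i) * K i j * Real.exp (s.v j + Real.log (c j / ∑ i, s.X i j))) :=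
      fun i j => rfl
    obtain ⟨hY, hcol⟩ := col_update hs.isScaling hpos h.col_pos hsc
    refine ⟨⟨hsc, hs.osc_left, ?_, fun h1 => ?_, fun _ => hcol⟩, ?_⟩
    · exact hsc.oscLe_right h.exp_le h.le_one h.pos h.le_col h.col_le_one hcol
    · simp only at h1
      omega
    · have h1 := sq_marginalError_le_of_row_update h.transpose (fun j i => hpos i j)
        (hs.row_sum hk) (fun j i => hY i j)
      rwa [marginalError_transpose, productGap_transpose,
        productGap_transpose (X := fun i j => Real.exp (s.u i) * K i j
          * Real.exp (s.v j + Real.log (c j / ∑ i, s.X i j)))] at h1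

theorem IsKernelBound.sum_kernel_pos (h : IsKernelBound K r c M b) : 0 < ∑ i, ∑ j, K i j :=
  Finset.sum_pos (fun i _ => Finset.sum_pos (fun j _ => h.kernel_pos i j) Finset.univ_nonempty)
    Finset.univ_nonempty

/-- `X_0` is normalised but the potentials start at 0, so the first update overshoots by the mass of
`K`. This iterate need not have mass 1, so regularity is claimed only from iterate 2 on. -/
theorem sinkhornIterate_one (h : IsKernelBound K r c M b) :
    (sinkhornIterate K r c 1).k = 1 ∧ (sinkhornIterate K r c 1).v = (fun _ => 0) ∧
      IsScaling K (sinkhornIterate K r c 1).u (sinkhornIterate K r c 1).v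
        (sinkhornIterate K r c 1).X ∧
      ∀ i, ∑ j, (sinkhornIterate K r c 1).X i j = (∑ i, ∑ j, K i j) * r i := by
  have hS := h.sum_kernel_pos
  have hpos : ∀ i j, 0 < (sinkhornIterate K r c 0).X i j := fun i j => by
    rw [sinkhornIterate_zero_X h]
    exact div_pos (h.kernel_pos i j) hS
  have hsum : ∀ i, 0 < ∑ j, (sinkhornIterate K r c 0).X i j := fun i =>
    Finset.sum_pos (fun j _ => hpos i j) Finset.univ_nonempty
  have hX : ∀ i j, (∑ i, ∑ j, K i j) * (sinkhornIterate K r c 0).X i j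
      = Real.exp ((sinkhornIterate K r c 0).u i) * K i j
        * Real.exp ((sinkhornIterate K r c 0).v j) := fun i j => by
    rw [sinkhornIterate_zero_X h]
    change _ = Real.exp 0 * K i j * Real.exp 0
    rw [Real.exp_zero]
    field_simp
  rw [sinkhornIterate_succ 0, sinkhornBody_val_of_even K r c _ rfl]
  exact ⟨rfl, rfl, fun i j => rfl, fun i => row_sum_of_row_update hsum
    (eq_of_row_update hX h.row_pos hsum fun i j => rfl) i⟩

theorem sinkhornIterate_one_osc (h : IsKernelBound K r c M b) :
    OscLe (sinkhornIterate K r c 1).u (M - Real.log b) ∧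
      OscLe (sinkhornIterate K r c 1).v (M - Real.log b) := by
  obtain ⟨-, h2, h3, h4⟩ := sinkhornIterate_one h
  refine ⟨h3.oscLe_left h.exp_le h.le_one h.pos h.le_row h.row_le_one h.sum_kernel_pos h4, ?_⟩
  rw [h2]
  intro j j'
  rw [sub_self]
  exact h.osc_nonneg

/-- With v = 0 the first iterate is `K` with rescaled rows. Comparing row sums of `K` costs e^M, and
comparing entries of `K` costs another e^M. -/
theorem sinkhornIterate_one_row_ratio (h : IsKernelBound K r c M b) (i i' : ι) (j : κ) :
    r i * (sinkhornIterate K r c 1).X i' j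
      ≤ Real.exp (2 * M) * (r i' * (sinkhornIterate K r c 1).X i j) := by
  obtain ⟨-, h2, h3, h4⟩ := sinkhornIterate_one h
  have hX : ∀ i j, (sinkhornIterate K r c 1).X i j
      = Real.exp ((sinkhornIterate K r c 1).u i) * K i j := fun i j => by
    rw [h3 i j, h2, Real.exp_zero, mul_one]
  have hK : ∀ i i' j j', K i j ≤ Real.exp M * K i' j' := fun i i' j j' => by
    refine (h.le_one i j).trans ?_
    calc (1 : ℝ) = Real.exp M * Real.exp (-M) := by rw [← Real.exp_add]; simp
      _ ≤ _ := mul_le_mul_of_nonneg_left (h.exp_le i' j') (Real.exp_pos _).le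
  simp_rw [hX] at h4 ⊢
  simp_rw [← Finset.mul_sum] at h4
  set e := fun i => Real.exp ((sinkhornIterate K r c 1).u i) with he
  have hepos : ∀ i, 0 < e i := fun i => Real.exp_pos _
  have hsum : ∑ k, K i k ≤ Real.exp M * ∑ k, K i' k := by
    rw [Finset.mul_sum]
    exact Finset.sum_le_sum fun k _ => hK i i' k k
  have hS := h.sum_kernel_pos
  refine le_of_mul_le_mul_left ?_ hS
  calc (∑ i, ∑ j, K i j) * (r i * (e i' * K i' j))
      = e i * (∑ k, K i k) * (e i' * K i' j) := by rw [h4 i]; ring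
    _ ≤ e i * (Real.exp M * ∑ k, K i' k) * (e i' * (Real.exp M * K i j)) := by
        have h5 := hepos i
        have h6 := hepos i'
        have h7 := h.kernel_pos i' j
        have h8 : 0 ≤ ∑ k, K i' k := Finset.sum_nonneg fun k _ => (h.kernel_pos i' k).le
        have h9 := hK i' i j j
        gcongr
    _ = (Real.exp M * Real.exp M) * ((e i' * ∑ k, K i' k) * (e i * K i j)) := by ring
    _ = (∑ i, ∑ j, K i j) * (Real.exp (2 * M) * (r i' * (e i * K i j))) := by
        rw [h4 i', ← Real.exp_add, two_mul]; ring

theorem sinkhornIterate_two (h : IsKernelBound K r c M b) :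
    IsRegularState K r c (M - Real.log b) (sinkhornIterate K r c 2) ∧
      productGap r c (sinkhornIterate K r c 2).X ≤ 2 * M := by
  obtain ⟨h1, h2, h3, h4⟩ := sinkhornIterate_one h
  have hratio := sinkhornIterate_one_row_ratio h
  have hu := (sinkhornIterate_one_osc h).1
  rw [sinkhornIterate_succ 1, sinkhornBody_val_of_odd K r c _ (by rw [h1])]
  set s := sinkhornIterate K r c 1 with hs
  have hpos := h3.pos h.kernel_pos
  have hsum : ∀ j, 0 < ∑ i, s.X i j := fun j =>
    Finset.sum_pos (fun i _ => hpos i j) Finset.univ_nonempty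
  have hsc : IsScaling K s.u (fun j => s.v j + Real.log (c j / ∑ i, s.X i j)) (fun i j =>
      Real.exp (s.u i) * K i j * Real.exp (s.v j + Real.log (c j / ∑ i, s.X i j))) :=
    fun i j => rfl
  obtain ⟨hY, hcol⟩ := col_update h3 hpos h.col_pos hsc
  refine ⟨⟨hsc, hu, hsc.oscLe_right h.exp_le h.le_one h.pos h.le_col h.col_le_one hcol,
    fun h0 => ?_, fun _ => hcol⟩, ?_⟩
  · simp only [h1] at h0
    omega
  · have hle : ∀ i j, Real.log (r i * c j) - Real.log (Real.exp (s.u i) * K i j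
        * Real.exp (s.v j + Real.log (c j / ∑ i, s.X i j))) ≤ 2 * M := fun i j => by
      -- Summing the ratio bound over i' uses that `r` has mass 1. After the column update it reads
      -- r_i c_j ≤ e^{2M} Y_ij, so the initial gap does not involve log b.
      have h5 : r i * ∑ i', s.X i' j ≤ Real.exp (2 * M) * s.X i j := by
        calc r i * ∑ i', s.X i' j ≤ ∑ i', Real.exp (2 * M) * (r i' * s.X i j) := by
              rw [Finset.mul_sum]
              exact Finset.sum_le_sum fun i' _ => hratio i i' j
          _ = _ := by rw [← Finset.mul_sum, ← Finset.sum_mul, h.sum_row, one_mul]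
      rw [hY i j]
      have h7 : r i * c j ≤ Real.exp (2 * M) * (c j / (∑ i, s.X i j) * s.X i j) := by
        rw [div_mul_eq_mul_div, mul_div_assoc', le_div_iff₀ (hsum j)]
        nlinarith [h.col_pos j]
      have h8 := Real.log_le_log (mul_pos (h.row_pos i) (h.col_pos j)) h7
      rw [Real.log_mul (Real.exp_pos _).ne'
        (mul_pos (div_pos (h.col_pos j) (hsum j)) (hpos i j)).ne', Real.log_exp] at h8
      linarith
    calc productGap r c _ ≤ ∑ i, ∑ j, r i * c j * (2 * M) :=
          Finset.sum_le_sum fun i _ => Finset.sum_le_sum fun j _ =>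
            mul_le_mul_of_nonneg_left (hle i j) (mul_pos (h.row_pos i) (h.col_pos j)).le
      _ = 2 * M := by
          simp_rw [mul_assoc, ← Finset.mul_sum, ← Finset.sum_mul, h.sum_col, h.sum_row, one_mul]

theorem isRegularState_sinkhornIterate (h : IsKernelBound K r c M b) (k : ℕ) :
    IsRegularState K r c (M - Real.log b) (sinkhornIterate K r c (k + 2)) := by
  induction k with
  | zero => exact (sinkhornIterate_two h).1
  | succ k ih =>
    rw [show k + 1 + 2 = (k + 2) + 1 by ring, sinkhornIterate_succ]
    exact (ih.next h).1

/-- The decreases of the gap telescope from at most 2M to a nonnegative value, and each is at least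
a quarter of a squared error. -/
theorem sum_sq_marginalError_le (h : IsKernelBound K r c M b) (N : ℕ) :
    ∑ k ∈ Finset.range N, marginalError r c (sinkhornIterate K r c (k + 2)).X ^ 2 ≤ 8 * M := by
  have key : ∑ k ∈ Finset.range N, marginalError r c (sinkhornIterate K r c (k + 2)).X ^ 2
      ≤ 4 * (productGap r c (sinkhornIterate K r c 2).X
        - productGap r c (sinkhornIterate K r c (N + 2)).X) := by
    induction N with
    | zero => simp
    | succ N ih =>
      have h1 := ((isRegularState_sinkhornIterate h N).next h).2
      rw [← sinkhornIterate_succ] at h1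
      rw [Finset.sum_range_succ, show N + 1 + 2 = N + 2 + 1 by ring]
      linarith
  have hN := isRegularState_sinkhornIterate h N
  linarith [(sinkhornIterate_two h).2,
    productGap_nonneg h (hN.isScaling.pos h.kernel_pos) (hN.sum_eq_one h)]

theorem mul_sq_le_of_lt_marginalError (h : IsKernelBound K r c M b) {δ : ℝ} (hδ : 0 ≤ δ) {N : ℕ}
    (hN : ∀ k < N, δ < marginalError r c (sinkhornIterate K r c (k + 2)).X) :
    N * δ ^ 2 ≤ 8 * M := by
  refine le_trans ?_ (sum_sq_marginalError_le h N)
  calc (N : ℝ) * δ ^ 2 = ∑ _k ∈ Finset.range N, δ ^ 2 := by simp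
    _ ≤ _ := Finset.sum_le_sum fun k hk =>
      pow_le_pow_left₀ hδ (hN k (Finset.mem_range.1 hk)).le 2

theorem exists_marginalError_le (h : IsKernelBound K r c M b) {δ : ℝ} (hδ : 0 < δ) :
    ∃ k, marginalError r c (sinkhornIterate K r c (k + 2)).X ≤ δ := by
  by_contra! hne
  obtain ⟨N, hN⟩ := exists_nat_gt (8 * M / δ ^ 2)
  rw [div_lt_iff₀ (by positivity)] at hN
  exact absurd (mul_sq_le_of_lt_marginalError h hδ.le (N := N) fun k _ => hne k) (not_le.2 hN)

theorem exists_isScaling_coupling (h : IsKernelBound K r c M b) :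
    ∃ X u v, IsScaling K u v X ∧ X ∈ couplings r c := by
  refine exists_isScaling_mem_couplings (J := M - Real.log b) h.exp_le h.le_one fun ε hε => ?_
  obtain ⟨k, hk⟩ := exists_marginalError_le h hε
  have hs := isRegularState_sinkhornIterate h k
  exact ⟨_, _, _, hs.isScaling, hs.osc_left, hs.osc_right, hs.sum_eq_one h, hk⟩

/-- Termination of `Sinkhorn`; for `δ = 0` this needs that the kernel is constant. -/
theorem exists_sinkhornRuns (h : IsKernelBound K r c M b) {δ : ℝ} (hδ : 0 ≤ δ)
    (hM : δ = 0 → M = 0) :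
    ∃ k t, SinkhornRuns K r c δ (sinkhornIterate K r c k).X t ∧
      marginalError r c (sinkhornIterate K r c k).X ≤ δ ∧
      (t : ℝ) ≤ (9 + 31 * (3 + 8 * M / δ ^ 2)) * (Fintype.card ι * Fintype.card κ) := by
  have hex : ∃ k, marginalError r c (sinkhornIterate K r c k).X ≤ δ := by
    -- For δ = 0 also M = 0, and the summed bound forces the error at iterate 2 to vanish.
    rcases hδ.eq_or_lt with h0 | hpos
    · refine ⟨2, ?_⟩
      have h1 := sum_sq_marginalError_le h 1
      rw [hM h0.symm, Finset.sum_range_one, mul_zero] at h1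
      rw [← h0, pow_eq_zero_iff two_ne_zero |>.1 (le_antisymm h1 (sq_nonneg _))]
    · obtain ⟨k, hk⟩ := exists_marginalError_le h hpos
      exact ⟨k + 2, hk⟩
  classical
  set k := Nat.find hex with hkdef
  have hk := Nat.find_spec hex
  rw [← hkdef] at hk
  have hlt : ∀ i < k, δ < marginalError r c (sinkhornIterate K r c i).X := fun i hi =>
    not_le.1 (Nat.find_min hex hi)
  obtain ⟨t, ht, hle⟩ := Timed.exists_whileRuns (test := sinkhornTest r c δ)
    (body := sinkhornBody K r c) (B := 31 * (Fintype.card ι * Fintype.card κ))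
    (fun s => by
      have := sinkhornTest_cost_le r c δ s
      have := sinkhornBody_cost_le K r c s
      omega) k
    (sinkhornInit K).val
    (fun i hi => by rw [sinkhornTest_val]; exact decide_eq_true (hlt i hi))
    (by rw [sinkhornTest_val]; exact decide_eq_false (not_lt.2 hk))
  refine ⟨k, _, ⟨_, t, ht, rfl, rfl⟩, hk, ?_⟩
  have hk2 : (k : ℝ) ≤ 2 + 8 * M / δ ^ 2 := by
    rcases le_or_gt k 2 with h2 | h2
    · have : (k : ℝ) ≤ 2 := by exact_mod_cast h2
      have := h.bound_nonneg
      have : 0 ≤ 8 * M / δ ^ 2 := by positivity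
      linarith
    · obtain ⟨N, hN⟩ := Nat.exists_eq_add_of_lt h2
      have h3 := mul_sq_le_of_lt_marginalError h hδ (N := N + 1) fun i hi => hlt (i + 2) (by omega)
      have hδ' : 0 < δ := by
        refine lt_of_le_of_ne hδ fun h0 => ?_
        have h1 := sum_sq_marginalError_le h 1
        rw [hM h0.symm, Finset.sum_range_one, mul_zero] at h1
        have h4 := hlt 2 h2
        rw [pow_eq_zero_iff two_ne_zero |>.1 (le_antisymm h1 (sq_nonneg _))] at h4
        linarith
      rw [← le_div_iff₀ (by positivity)] at h3
      rw [hN]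
      push_cast at h3 ⊢
      linarith
  have h1 := sinkhornInit_cost_le K
  have h2 : ((sinkhornInit K).cost + t : ℕ) ≤
      (9 + 31 * (k + 1)) * (Fintype.card ι * Fintype.card κ) := by
    nlinarith
  have h3 : (((sinkhornInit K).cost + t : ℕ) : ℝ)
      ≤ (9 + 31 * (k + 1)) * (Fintype.card ι * Fintype.card κ) := by exact_mod_cast h2
  refine h3.trans (mul_le_mul_of_nonneg_right (by linarith) (by positivity))

end

/-! ### The algorithm `Round` -/

section

variable {ι κ : Type} [Fintype κ] {F : ι → κ → ℝ} {r : ι → ℝ}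

/-- `diag(min(r / (F 1), 1)) F`. -/
def capRows (F : ι → κ → ℝ) (r : ι → ℝ) (i : ι) (j : κ) : ℝ := min (r i / ∑ j, F i j) 1 * F i j

theorem capRows_le (hF : ∀ i j, 0 < F i j) (i : ι) (j : κ) : capRows F r i j ≤ F i j :=
  mul_le_of_le_one_left (hF i j).le (min_le_right _ _)

theorem capRows_pos (hF : ∀ i j, 0 < F i j) (hr : ∀ i, 0 < r i) [Nonempty κ] (i : ι) (j : κ) :
    0 < capRows F r i j :=
  mul_pos (lt_min (div_pos (hr i) (Finset.sum_pos (fun j _ => hF i j) Finset.univ_nonempty))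
    one_pos) (hF i j)

theorem sum_capRows (hF : ∀ i j, 0 < F i j) [Nonempty κ] (i : ι) :
    ∑ j, capRows F r i j = min (r i) (∑ j, F i j) := by
  have h : 0 < ∑ j, F i j := Finset.sum_pos (fun j _ => hF i j) Finset.univ_nonempty
  simp_rw [capRows, ← Finset.mul_sum]
  rw [min_mul_of_nonneg _ _ h.le, div_mul_cancel₀ _ h.ne', one_mul]

end

section

variable {ι κ : Type} [Fintype ι] [Fintype κ] {K F X Y : ι → κ → ℝ} {u : ι → ℝ} {v : κ → ℝ}
  {r : ι → ℝ} {c : κ → ℝ} {M b : ℝ}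

/-- The matrix `F''` of `Round`. -/
def capBoth (F : ι → κ → ℝ) (r : ι → ℝ) (c : κ → ℝ) (i : ι) (j : κ) : ℝ :=
  capRows (fun j i => capRows F r i j) c j i

theorem round_val (F : ι → κ → ℝ) (r : ι → ℝ) (c : κ → ℝ) :
    (round F r c).val = fun i j => capBoth F r c i j
      + (r i - ∑ j, capBoth F r c i j) * (c j - ∑ i, capBoth F r c i j)
        / ∑ i, |r i - ∑ j, capBoth F r c i j| := by
  have h : capBoth F r c = fun i j => capRows F r i j * min (c j / ∑ i, capRows F r i j) 1 := by
    funext i j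
    exact mul_comm _ _
  rw [h]
  rfl

/-- Capping leaves nonnegative row and column deficits of equal total `N`, and the rank-one term
fills both. The distance is at most the mass removed plus the mass `N` added. -/
theorem round_mem_couplings_and_norm1_le [Nonempty ι] [Nonempty κ] (hF : ∀ i j, 0 < F i j)
    (hr : ∀ i, 0 < r i) (hc : ∀ j, 0 < c j) (hr1 : ∑ i, r i = 1) (hc1 : ∑ j, c j = 1) :
    (round F r c).val ∈ couplings r c ∧
      norm1 (fun i j => (round F r c).val i j - F i j) ≤ 3 * marginalError r c F := by
  rw [round_val]
  have hpos' := capRows_pos (r := r) hF hr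
  have hle' := capRows_le (r := r) hF
  have hsum' := sum_capRows (r := r) hF
  have hpos : ∀ i j, 0 < capBoth F r c i j := fun i j =>
    capRows_pos (fun j i => hpos' i j) hc j i
  have hle : ∀ i j, capBoth F r c i j ≤ capRows F r i j := fun i j =>
    capRows_le (fun j i => hpos' i j) j i
  have hsum : ∀ j, ∑ i, capBoth F r c i j = min (c j) (∑ i, capRows F r i j) := fun j =>
    sum_capRows (fun j i => hpos' i j) j
  set G := capBoth F r c
  have heR : ∀ i, 0 ≤ r i - ∑ j, G i j := fun i => by
    have h1 : ∑ j, G i j ≤ ∑ j, capRows F r i j := Finset.sum_le_sum fun j _ => hle i j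
    rw [hsum' i] at h1
    linarith [min_le_left (r i) (∑ j, F i j)]
  have heC : ∀ j, 0 ≤ c j - ∑ i, G i j := fun j => by
    rw [hsum j]
    linarith [min_le_left (c j) (∑ i, capRows F r i j)]
  have hN : ∑ i, |r i - ∑ j, G i j| = ∑ i, (r i - ∑ j, G i j) :=
    Finset.sum_congr rfl fun i _ => abs_of_nonneg (heR i)
  have hNC : ∑ j, (c j - ∑ i, G i j) = ∑ i, (r i - ∑ j, G i j) := by
    rw [Finset.sum_sub_distrib, Finset.sum_sub_distrib, hr1, hc1, Finset.sum_comm]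
  rw [hN]
  set N := ∑ i, (r i - ∑ j, G i j) with hNdef
  have hN0 : 0 ≤ N := Finset.sum_nonneg fun i _ => heR i
  have hR : ∀ i, ∑ j, (r i - ∑ j, G i j) * (c j - ∑ i, G i j) / N = r i - ∑ j, G i j := fun i => by
    rw [← Finset.sum_div, ← Finset.mul_sum, hNC]
    -- If N = 0, all deficits vanish and the quotient is 0 by the convention x / 0 = 0.
    rcases hN0.eq_or_lt with h0 | h0
    · rw [(Finset.sum_eq_zero_iff_of_nonneg fun i _ => heR i).1 h0.symm i (Finset.mem_univ i)]
      simp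
    · exact mul_div_cancel_right₀ _ h0.ne'
  have hC : ∀ j, ∑ i, (r i - ∑ j, G i j) * (c j - ∑ i, G i j) / N = c j - ∑ i, G i j := fun j => by
    rw [← Finset.sum_div, ← Finset.sum_mul, ← hNdef]
    rcases hN0.eq_or_lt with h0 | h0
    · rw [(Finset.sum_eq_zero_iff_of_nonneg fun j _ => heC j).1 (hNC.trans h0.symm) j
        (Finset.mem_univ j)]
      simp
    · exact mul_div_cancel_left₀ _ h0.ne'
  have hnn : ∀ i j, 0 ≤ (r i - ∑ j, G i j) * (c j - ∑ i, G i j) / N := fun i j =>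
    div_nonneg (mul_nonneg (heR i) (heC j)) hN0
  refine ⟨⟨fun i j => add_nonneg (hpos i j).le (hnn i j), fun i => ?_, fun j => ?_⟩, ?_⟩
  · rw [Finset.sum_add_distrib, hR i]
    ring
  · rw [Finset.sum_add_distrib, hC j]
    ring
  · have h1 : norm1 (fun i j => G i j + (r i - ∑ j, G i j) * (c j - ∑ i, G i j) / N - F i j)
        ≤ ∑ i, ∑ j, (F i j - G i j) + N := by
      calc _ ≤ ∑ i, ∑ j, ((F i j - G i j) + (r i - ∑ j, G i j) * (c j - ∑ i, G i j) / N) :=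
            Finset.sum_le_sum fun i _ => Finset.sum_le_sum fun j _ => by
              rw [abs_le]
              constructor <;> linarith [hnn i j, hle i j, hle' i j]
        _ = _ := by
            simp_rw [Finset.sum_add_distrib, hR]
            rfl
    have h2 : ∑ i, ∑ j, (F i j - capRows F r i j) ≤ ∑ i, |∑ j, F i j - r i| :=
      Finset.sum_le_sum fun i _ => by
        rw [Finset.sum_sub_distrib, hsum' i]
        rcases le_total (r i) (∑ j, F i j) with h | h
        · rw [min_eq_left h]
          exact le_abs_self _
        · rw [min_eq_right h, sub_self]
          exact abs_nonneg _
    have h3 : ∑ j, ∑ i, (capRows F r i j - G i j) ≤ ∑ j, |∑ i, F i j - c j| :=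
      Finset.sum_le_sum fun j _ => by
        have h4 : ∑ i, capRows F r i j ≤ ∑ i, F i j := Finset.sum_le_sum fun i _ => hle' i j
        rw [Finset.sum_sub_distrib, hsum j]
        rcases le_total (c j) (∑ i, capRows F r i j) with h | h
        · rw [min_eq_left h]
          linarith [le_abs_self (∑ i, F i j - c j)]
        · rw [min_eq_right h, sub_self]
          exact abs_nonneg _
    rw [Finset.sum_comm] at h3
    have h4 : ∑ i, ∑ j, (F i j - G i j) ≤ marginalError r c F := by
      refine le_trans (le_of_eq ?_) (add_le_add h2 h3)
      simp_rw [← Finset.sum_add_distrib, sub_add_sub_cancel]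
    -- `F` need not have mass 1, so the added mass can differ from the removed mass by up to one
    -- marginal error; hence the constant 3.
    have h5 : N = ∑ i, ∑ j, (F i j - G i j) + ∑ i, (r i - ∑ j, F i j) := by
      rw [hNdef, ← Finset.sum_add_distrib]
      exact Finset.sum_congr rfl fun i _ => by rw [Finset.sum_sub_distrib]; ring
    have h6 : ∑ i, (r i - ∑ j, F i j) ≤ marginalError r c F := by
      refine le_trans (Finset.sum_le_sum fun i _ => ?_) (le_add_of_nonneg_right
        (Finset.sum_nonneg fun j _ => abs_nonneg _))
      rw [abs_sub_comm]
      exact le_abs_self _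
    linarith

theorem round_cost_le [Nonempty ι] [Nonempty κ] (F : ι → κ → ℝ) (r : ι → ℝ) (c : κ → ℝ) :
    (round F r c).cost ≤ 36 * (Fintype.card ι * Fintype.card κ) := by
  have h1 := Nat.one_le_iff_ne_zero.2 (Fintype.card_ne_zero (α := ι))
  have h2 := Nat.one_le_iff_ne_zero.2 (Fintype.card_ne_zero (α := κ))
  simp only [round, rowSums, colSums, cappedRatio, vecSub, vecNorm1, Timed.bind_cost,
    Timed.pure_cost, Timed.sum, Timed.tabulate, Timed.add, Timed.sub, Timed.mul, Timed.div,
    Timed.min,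
    Timed.abs, Finset.sum_const, Finset.card_univ, smul_eq_mul]
  nlinarith

/-! ### Proximity of the iterates to normalised scalings -/

/-- Every iterate of `Sinkhorn` is close to a normalised scaling with bounded potentials. -/
theorem exists_isScaling_near_sinkhornIterate [Nonempty ι] [Nonempty κ]
    (h : IsKernelBound K r c M b) (k : ℕ) :
    (∀ i j, 0 < (sinkhornIterate K r c k).X i j) ∧ ∃ Y u v, IsScaling K u v Y ∧
      OscLe u (M - Real.log b) ∧ OscLe v (M - Real.log b) ∧ ∑ i, ∑ j, Y i j = 1 ∧
      marginalError r c Y ≤ marginalError r c (sinkhornIterate K r c k).X ∧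
      norm1 (fun i j => (sinkhornIterate K r c k).X i j - Y i j)
        ≤ marginalError r c (sinkhornIterate K r c k).X := by
  have hS := h.sum_kernel_pos
  have hself : ∀ X : ι → κ → ℝ, norm1 (fun i j => X i j - X i j) ≤ marginalError r c X :=
      fun X => by
    simpa [norm1] using marginalError_nonneg r c X
  match k with
  | 0 =>
    refine ⟨fun i j => ?_, (sinkhornIterate K r c 0).X,
      fun _ => -Real.log (∑ i, ∑ j, K i j), fun _ => 0,
      fun i j => ?_, fun i i' => ?_, fun j j' => ?_, ?_, le_rfl, hself _⟩
    · rw [sinkhornIterate_zero_X h]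
      exact div_pos (h.kernel_pos i j) hS
    · rw [sinkhornIterate_zero_X h, Real.exp_neg, Real.exp_log hS, Real.exp_zero]
      field_simp
    · rw [sub_self]
      exact h.osc_nonneg
    · rw [sub_self]
      exact h.osc_nonneg
    · simp_rw [sinkhornIterate_zero_X h, ← Finset.sum_div]
      exact div_self hS.ne'
  -- Dividing by the mass S makes the row sums exact. The distance moved is |S - 1|, which is
  -- precisely the row error given up, so the total marginal error does not grow.
  | 1 =>
    obtain ⟨-, -, hsc, hrow⟩ := sinkhornIterate_one h
    obtain ⟨hu, hv⟩ := sinkhornIterate_one_osc h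
    have hpos := hsc.pos h.kernel_pos
    set s := sinkhornIterate K r c 1
    set S := ∑ i, ∑ j, K i j
    have hrow' : ∀ i, ∑ j, s.X i j / S = r i := fun i => by
      rw [← Finset.sum_div, hrow i, mul_div_cancel_left₀ _ hS.ne']
    have hrowerr : ∑ i, |∑ j, s.X i j - r i| = |S - 1| := by
      calc ∑ i, |∑ j, s.X i j - r i| = ∑ i, |S - 1| * r i :=
            Finset.sum_congr rfl fun i _ => by
              rw [hrow i, ← abs_of_pos (h.row_pos i), ← abs_mul, abs_of_pos (h.row_pos i)]
              ring_nf
        _ = |S - 1| := by rw [← Finset.mul_sum, h.sum_row, mul_one]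
    have hsumX : ∑ i, ∑ j, s.X i j = S := by
      simp_rw [hrow, ← Finset.mul_sum, h.sum_row, mul_one]
    have hcolS : ∑ j, |∑ i, s.X i j / S - ∑ i, s.X i j| = |S - 1| := by
      have h1 : ∀ j, |∑ i, s.X i j / S - ∑ i, s.X i j| = |S - 1| / S * ∑ i, s.X i j := fun j => by
        have h2 : 0 ≤ ∑ i, s.X i j := Finset.sum_nonneg fun i _ => (hpos i j).le
        rw [← abs_of_pos hS, ← abs_div, abs_of_pos hS, ← abs_of_nonneg h2, ← abs_mul,
          abs_of_nonneg h2, ← Finset.sum_div, ← abs_neg]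
        congr 1
        field_simp
        ring
      simp_rw [h1, ← Finset.mul_sum]
      rw [Finset.sum_comm, hsumX, div_mul_cancel₀ _ hS.ne']
    refine ⟨hpos, fun i j => s.X i j / S, fun i => s.u i - Real.log S, s.v, fun i j => ?_,
      fun i i' => ?_, hv, ?_, ?_, ?_⟩
    · change s.X i j / S = Real.exp (s.u i - Real.log S) * K i j * Real.exp (s.v j)
      rw [hsc i j, Real.exp_sub, Real.exp_log hS]
      field_simp
    · linarith [hu i i']
    · simp_rw [hrow', h.sum_row]
    · unfold marginalError
      simp_rw [hrowerr, hrow', sub_self, abs_zero, Finset.sum_const_zero, zero_add]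
      rw [← hcolS, ← Finset.sum_add_distrib]
      exact Finset.sum_le_sum fun j _ => abs_sub_le _ _ _
    · refine le_trans (le_of_eq ?_) (le_add_of_nonneg_right
        (Finset.sum_nonneg fun j _ => abs_nonneg _))
      rw [hrowerr]
      have h1 : ∀ i j, |s.X i j - s.X i j / S| = |S - 1| / S * s.X i j := fun i j => by
        rw [← abs_of_pos hS, ← abs_div, abs_of_pos hS, ← abs_of_pos (hpos i j), ← abs_mul,
          abs_of_pos (hpos i j)]
        congr 1
        field_simp
      unfold norm1
      simp_rw [h1, ← Finset.mul_sum, hsumX, div_mul_cancel₀ _ hS.ne']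
  | k + 2 =>
    have hs := isRegularState_sinkhornIterate h k
    exact ⟨hs.isScaling.pos h.kernel_pos, _, _, _, hs.isScaling, hs.osc_left, hs.osc_right,
      hs.sum_eq_one h, le_rfl, hself _⟩

/-! ### Choice of the parameters -/

theorem isKernelBound_exp [Nonempty ι] [Nonempty κ] {C : ι → κ → ℝ} {ξ : ℝ} (hr : ∀ i, 0 < r i)
    (hc : ∀ j, 0 < c j) (hr1 : ∑ i, r i = 1) (hc1 : ∑ j, c j = 1) (hC : ∀ i j, 0 ≤ C i j)
    (hξ : 0 < ξ) : IsKernelBound (fun i j => Real.exp (-(ξ * C i j))) r c (ξ * normInf C)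
      (minEntry r c) where
  exp_le i j := by
    have h1 : |C i j| ≤ ⨆ j, |C i j| := le_ciSup (Finite.bddAbove_range fun j => |C i j|) j
    have h2 : ⨆ j, |C i j| ≤ normInf C := le_ciSup (Finite.bddAbove_range fun i => ⨆ j, |C i j|) i
    exact Real.exp_le_exp.2 (neg_le_neg (mul_le_mul_of_nonneg_left
      ((le_abs_self _).trans (h1.trans h2)) hξ.le))
  le_one i j := Real.exp_le_one_iff.2 (neg_nonpos.2 (mul_nonneg hξ.le (hC i j)))
  pos := by
    obtain ⟨i, hi⟩ := exists_eq_ciInf_of_finite (f := r)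
    obtain ⟨j, hj⟩ := exists_eq_ciInf_of_finite (f := c)
    rw [minEntry, ← hi, ← hj]
    exact lt_min (hr i) (hc j)
  le_row i := (min_le_left _ _).trans (ciInf_le (Finite.bddBelow_range r) i)
  le_col j := (min_le_right _ _).trans (ciInf_le (Finite.bddBelow_range c) j)
  sum_row := hr1
  sum_col := hc1

/-- The entries of `r` are at least `b` and sum to 1. This bounds J below by the logarithm of the
dimension. -/
theorem IsKernelBound.log_card_row_le [Nonempty ι] (h : IsKernelBound K r c M b) :
    Real.log (Fintype.card ι) ≤ -Real.log b := by
  have h1 : (Fintype.card ι : ℝ) * b ≤ 1 := by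
    rw [← h.sum_row, ← nsmul_eq_mul, ← Finset.card_univ, ← Finset.sum_const]
    exact Finset.sum_le_sum fun i _ => h.le_row i
  rw [← Real.log_inv]
  refine Real.log_le_log (by exact_mod_cast Fintype.card_pos) ?_
  rwa [le_inv_comm₀ (by exact_mod_cast Fintype.card_pos) h.pos, ← one_div, le_div_iff₀
    (by exact_mod_cast Fintype.card_pos), mul_comm]

/-- The accuracy `ε'` with which `Sinkhorn` is called, as a function of the largest dimension. -/
def tolerance (d : ℕ) (J ε : ℝ) : ℝ :=
  if d ≤ 2 then ε * ε / (8 * J) * Real.log 2 else ε * ε / (8 * J)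

theorem tolerance_nonneg {d : ℕ} {J ε : ℝ} (hJ : 0 ≤ J) : 0 ≤ tolerance d J ε := by
  have h1 : 0 ≤ ε * ε / (8 * J) := div_nonneg (mul_self_nonneg ε) (by linarith)
  unfold tolerance
  split_ifs
  · exact mul_nonneg h1 (Real.log_nonneg one_le_two)
  · exact h1

theorem eq_zero_of_tolerance_eq_zero {d : ℕ} {J ε : ℝ} (hε : 0 < ε) (h : tolerance d J ε = 0) :
    J = 0 := by
  have h2 : Real.log 2 ≠ 0 := (Real.log_pos one_lt_two).ne'
  have h3 : ε * ε / (8 * J) = 0 := by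
    unfold tolerance at h
    split_ifs at h
    · exact (mul_eq_zero.1 h).resolve_right h2
    · exact h
  rcases div_eq_zero_iff.1 h3 with h4 | h4
  · exact absurd h4 (mul_pos hε hε).ne'
  · linarith

theorem mul_tolerance_le {d : ℕ} {J ε : ℝ} (hJ : 0 < J) :
    2 * J * tolerance d J ε ≤ ε ^ 2 / 4 := by
  have h1 : 2 * J * (ε * ε / (8 * J)) = ε ^ 2 / 4 := by field_simp; ring
  unfold tolerance
  split_ifs
  · rw [← mul_assoc, h1]
    exact mul_le_of_le_one_right (by positivity) (by linarith [Real.log_two_lt_d9])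
  · exact h1.le

/-- What is needed is ε ≤ J, up to the extra factor. In dimension at least 3, J ≥ log 3 ≥ 1; in
dimension 2 only J ≥ log 2 is known, and the factor log 2 in the tolerance compensates. -/
theorem tolerance_le {d : ℕ} {J ε : ℝ} (hε : 0 < ε) (hε1 : ε < 1) (hd : 2 ≤ d)
    (hJ : Real.log d ≤ J) : tolerance d J ε ≤ ε / 8 := by
  have hl := Real.log_pos one_lt_two
  have h2 : Real.log 2 ≤ J := (Real.log_le_log two_pos (by exact_mod_cast hd)).trans hJ
  have hJ0 : 0 < J := hl.trans_le h2
  have h3 : ε * ε ≤ ε := mul_le_of_le_one_left hε.le hε1.le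
  unfold tolerance
  split_ifs with h
  · rw [div_mul_eq_mul_div, div_le_iff₀ (by positivity)]
    nlinarith [mul_le_mul h3 h2 hl.le hε.le]
  · have h4 : (3 : ℝ) ≤ d := by exact_mod_cast (not_le.1 h)
    have h5 : 1 ≤ J := by
      refine le_trans ?_ hJ
      rw [Real.le_log_iff_exp_le (by linarith)]
      linarith [Real.exp_one_lt_d9]
    rw [div_le_iff₀ (by positivity)]
    nlinarith

theorem div_sq_tolerance_le {d : ℕ} {M L ε : ℝ} (hM : 0 ≤ M) (hL : 0 ≤ L) (hε : 0 < ε) :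
    8 * M / tolerance d (M + L) ε ^ 2 ≤ 2200 * ((ε ^ 4)⁻¹ * M * (M ^ 2 + L ^ 2)) := by
  rcases hM.eq_or_lt with rfl | hM
  · simp
  have hJ : 0 < M + L := by linarith
  have hlog : 12 / 25 ≤ Real.log 2 ^ 2 := by nlinarith [Real.log_two_gt_d9]
  have hlog1 : Real.log 2 ^ 2 ≤ 1 := by nlinarith [Real.log_two_gt_d9, Real.log_two_lt_d9]
  have h1 : (ε * ε / (8 * (M + L))) ^ 2 * (12 / 25) ≤ tolerance d (M + L) ε ^ 2 := by
    unfold tolerance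
    split_ifs
    · rw [mul_pow]
      gcongr
    · exact mul_le_of_le_one_right (sq_nonneg _) (by norm_num)
  have h2 : 0 < (ε * ε / (8 * (M + L))) ^ 2 * (12 / 25) := by positivity
  calc 8 * M / tolerance d (M + L) ε ^ 2
      ≤ 8 * M / ((ε * ε / (8 * (M + L))) ^ 2 * (12 / 25)) := by gcongr
    -- The constant is 8 · 64 · 25/12, where 12/25 is a lower bound for (log 2)²; doubling it below
    -- gives 6400/3 ≤ 2200.
    _ = 3200 / 3 * ((ε ^ 4)⁻¹ * M * (M + L) ^ 2) := by field_simp; norm_num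
    _ ≤ 3200 / 3 * ((ε ^ 4)⁻¹ * M * (2 * (M ^ 2 + L ^ 2))) := by
        gcongr
        nlinarith [sq_nonneg (M - L)]
    _ ≤ _ := by
        have : 0 ≤ (ε ^ 4)⁻¹ * M * (M ^ 2 + L ^ 2) := by positivity
        linarith

/-! ### Accuracy and running time on positive marginals -/

theorem eq_of_mem_couplings_of_subsingleton [Subsingleton κ] (hX : X ∈ couplings r c)
    (hY : Y ∈ couplings r c) : X = Y := by
  have key : ∀ Z ∈ couplings r c, ∀ i j, Z i j = r i := fun Z hZ i j => by
    rw [← hZ.2.1 i, Fintype.sum_subsingleton _ j]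
  funext i j
  rw [key X hX, key Y hY]

theorem IsScaling.oscLe_of_mem_couplings [Nonempty ι] [Nonempty κ] (h : IsKernelBound K r c M b)
    (hX : IsScaling K u v X) (hXc : X ∈ couplings r c) :
    OscLe u (M - Real.log b) ∧ OscLe v (M - Real.log b) :=
  ⟨hX.oscLe_left h.exp_le h.le_one h.pos h.le_row h.row_le_one one_pos fun i => by
      rw [one_mul, hXc.2.1],
    hX.oscLe_right h.exp_le h.le_one h.pos h.le_col h.col_le_one hXc.2.2⟩

/-- Accuracy of the rounded output of `Sinkhorn`. -/
theorem norm1_round_sub_le [Nonempty ι] [Nonempty κ] (h : IsKernelBound K r c M b)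
    (hX : IsScaling K u v X) (hXc : X ∈ couplings r c) {k : ℕ} {δ ε : ℝ} (hε : 0 < ε)
    (hk : marginalError r c (sinkhornIterate K r c k).X ≤ δ)
    (hδ : 2 * (M - Real.log b) * δ ≤ ε ^ 2 / 4) (hδε : δ ≤ ε / 8) :
    norm1 (fun i j => (round (sinkhornIterate K r c k).X r c).val i j - X i j) ≤ ε := by
  obtain ⟨hpos, Y, u', v', hY, hu', hv', hY1, herr, hnear⟩ :=
    exists_isScaling_near_sinkhornIterate h k
  have h1 := (round_mem_couplings_and_norm1_le hpos h.row_pos h.col_pos h.sum_row h.sum_col).2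
  have ⟨hu, hv⟩ := hX.oscLe_of_mem_couplings h hXc
  have h2 := sq_norm1_sub_le_of_isScaling h.kernel_pos hX hY hu hv hu' hv' hXc.2.1 hXc.2.2
    (sum_coupling hXc h.sum_row) hY1
  have h3 : norm1 (fun i j => Y i j - X i j) ≤ ε / 2 := by
    refine le_of_sq_le_sq ?_ (by linarith)
    calc _ ≤ 2 * (M - Real.log b) * marginalError r c Y := h2
      _ ≤ 2 * (M - Real.log b) * δ :=
          mul_le_mul_of_nonneg_left (herr.trans hk) (by linarith [h.osc_nonneg])
      _ ≤ (ε / 2) ^ 2 := by linarith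
  -- The error budget is 3δ for rounding, δ from the iterate to `Y`, and ε/2 from `Y` to `X`; δ ≤
  -- ε/8 closes it.
  have h4 := norm1_sub_le (round (sinkhornIterate K r c k).X r c).val (sinkhornIterate K r c k).X Y
  have h5 := norm1_sub_le (round (sinkhornIterate K r c k).X r c).val Y X
  linarith

theorem exists_sinkhornRuns_round [Nonempty ι] [Nonempty κ] (h : IsKernelBound K r c M b)
    (hX : IsScaling K u v X) (hXc : X ∈ couplings r c) {ε : ℝ} (hε : 0 < ε) (hε1 : ε < 1) :
    ∃ X' t, SinkhornRuns K r c
        (tolerance (max (Fintype.card ι) (Fintype.card κ)) (M - Real.log b) ε) X' t ∧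
      (round X' r c).val ∈ couplings r c ∧
      norm1 (fun i j => (round X' r c).val i j - X i j) ≤ ε ∧
      (t : ℝ) ≤ (102 + 68200 * ((ε ^ 4)⁻¹ * M * (M ^ 2 + Real.log b⁻¹ ^ 2)))
        * (Fintype.card ι * Fintype.card κ) := by
  set d := max (Fintype.card ι) (Fintype.card κ) with hd
  have hM := h.bound_nonneg
  have hb := h.log_nonpos
  obtain ⟨k, t, hrun, hk, ht⟩ := exists_sinkhornRuns h (tolerance_nonneg (d := d) (ε := ε)
    h.osc_nonneg) (fun h0 => by
      have := eq_zero_of_tolerance_eq_zero hε h0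
      linarith)
  obtain ⟨hpos, -⟩ := exists_isScaling_near_sinkhornIterate h k
  have hround := (round_mem_couplings_and_norm1_le hpos h.row_pos h.col_pos h.sum_row h.sum_col).1
  refine ⟨_, t, hrun, hround, ?_, ht.trans ?_⟩
  -- In dimension 1, J may be 0 and the tolerance estimates fail, but there is only one coupling.
  · rcases le_or_gt d 1 with h1 | h1
    · have : Subsingleton κ := Fintype.card_le_one_iff_subsingleton.1 ((le_max_right _ _).trans h1)
      rw [eq_of_mem_couplings_of_subsingleton hround hXc]
      simpa [norm1] using hε.le
    · have hlog : Real.log d ≤ M - Real.log b := by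
        have h2 := h.log_card_row_le
        have h3 := h.transpose.log_card_row_le
        rcases max_choice (Fintype.card ι) (Fintype.card κ) with h4 | h4 <;>
        · rw [hd, h4]
          linarith
      have hJ : 0 < M - Real.log b := (Real.log_pos (by exact_mod_cast h1)).trans_le hlog
      exact norm1_round_sub_le h hX hXc hε hk (mul_tolerance_le hJ) (tolerance_le hε hε1 h1 hlog)
  · have h1 := div_sq_tolerance_le (d := d) hM (neg_nonneg.2 hb) hε
    rw [← sub_eq_add_neg] at h1
    rw [Real.log_inv]
    refine mul_le_mul_of_nonneg_right ?_ (by positivity)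
    linarith

end

/-! ### The algorithm `ApproxOT` -/

section

variable {m n : ℕ} {r : Fin m → ℝ} {c : Fin n → ℝ} {C : Fin m → Fin n → ℝ} {ξ ε : ℝ}

theorem prepare_val (r : Fin m → ℝ) (c : Fin n → ℝ) (C : Fin m → Fin n → ℝ) (ξ ε : ℝ) :
    (prepare r c C ξ ε).val = ⟨fun i => r i, fun j => c j, fun i j => Real.exp (-(ξ * C i j)),
      tolerance (max (Fintype.card (Pos r)) (Fintype.card (Pos c)))
        (ξ * normInf (fun (i : Pos r) (j : Pos c) => C i j)
          - Real.log (minEntry (fun i : Pos r => r i) (fun j : Pos c => c j))) ε⟩ := by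
  have h : (prepare r c C ξ ε).val = ⟨fun i => r i, fun j => c j,
      fun i j => Real.exp (-(ξ * C i j)),
      if decide (max (Fintype.card (Pos r)) (Fintype.card (Pos c)) ≤ 2) = true then
        ε * ε / (8 * (ξ * normInf (fun (i : Pos r) (j : Pos c) => C i j)
          - Real.log (minEntry (fun i : Pos r => r i) (fun j : Pos c => c j)))) * Real.log 2
      else ε * ε / (8 * (ξ * normInf (fun (i : Pos r) (j : Pos c) => C i j)
          - Real.log (minEntry (fun i : Pos r => r i) (fun j : Pos c => c j))))⟩ := rfl
  rw [h]
  simp only [decide_eq_true_eq, tolerance]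

theorem card_pos_eq (hr : ∀ i, 0 < r i) : Fintype.card (Pos r) = m :=
  (Fintype.card_congr (Equiv.subtypeUnivEquiv hr)).trans (Fintype.card_fin m)

theorem sum_pos_eq (hr : ∀ i, 0 < r i) (f : Pos r → ℝ) : ∑ i, f i = ∑ i, f ⟨i, hr i⟩ :=
  ((Equiv.subtypeUnivEquiv hr).symm.sum_comp f).symm

theorem mem_couplings_of_pos (hr : ∀ i, 0 < r i) (hc : ∀ j, 0 < c j) {X : Pos r → Pos c → ℝ}
    (hX : X ∈ couplings (fun i : Pos r => r i) (fun j : Pos c => c j)) :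
    (fun i j => X ⟨i, hr i⟩ ⟨j, hc j⟩) ∈ couplings r c :=
  ⟨fun i j => hX.1 _ _, fun i => by rw [← sum_pos_eq hc (X ⟨i, hr i⟩), hX.2.1],
    fun j => by rw [← sum_pos_eq hr fun i => X i ⟨j, hc j⟩, hX.2.2]⟩

theorem norm1_pos_eq (hr : ∀ i, 0 < r i) (hc : ∀ j, 0 < c j) (X : Pos r → Pos c → ℝ) :
    norm1 X = norm1 (fun i j => X ⟨i, hr i⟩ ⟨j, hc j⟩) := by
  unfold norm1
  rw [sum_pos_eq hr]
  exact Finset.sum_congr rfl fun i _ => sum_pos_eq hc _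

theorem normInf_pos_eq (hr : ∀ i, 0 < r i) (hc : ∀ j, 0 < c j) :
    normInf (fun (i : Pos r) (j : Pos c) => C i j) = normInf C := by
  unfold normInf
  rw [← (Equiv.subtypeUnivEquiv hr).iSup_comp]
  exact iSup_congr fun i => (Equiv.subtypeUnivEquiv hc).iSup_comp (g := fun j => |C i j|)

theorem minEntry_pos_eq (hr : ∀ i, 0 < r i) (hc : ∀ j, 0 < c j) :
    minEntry (fun i : Pos r => r i) (fun j : Pos c => c j) = minEntry r c := by
  unfold minEntry
  rw [← (Equiv.subtypeUnivEquiv hr).iInf_comp (g := r),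
    ← (Equiv.subtypeUnivEquiv hc).iInf_comp (g := c)]
  rfl

theorem prepare_cost_le (hr : ∀ i, 0 < r i) (hc : ∀ j, 0 < c j) (hm : 1 ≤ m) (hn : 1 ≤ n) :
    (prepare r c C ξ ε).cost ≤ 40 * (m * n) := by
  simp only [prepare, Timed.bind_cost, Timed.pure_cost, Timed.tabulate, Timed.lt, Timed.maximum,
    Timed.minimum, Timed.abs, Timed.min, Timed.log, Timed.mul, Timed.sub, Timed.div, Timed.natMax,
    Timed.natLe,
    Timed.neg, Timed.exp, Finset.sum_const, Finset.card_univ, smul_eq_mul, card_pos_eq hr,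
    card_pos_eq hc, Fintype.card_fin]
  nlinarith

theorem finish_val (hr : ∀ i, 0 < r i) (hc : ∀ j, 0 < c j) (D : Restricted r c)
    (X : Pos r → Pos c → ℝ) (i : Fin m) (j : Fin n) :
    (finish r c D X).val i j = (round X D.rPos D.cPos).val ⟨i, hr i⟩ ⟨j, hc j⟩ :=
  dif_pos (⟨hr i, hc j⟩ : 0 < r i ∧ 0 < c j)

theorem finish_cost_le (hr : ∀ i, 0 < r i) (hc : ∀ j, 0 < c j) (hm : 1 ≤ m) (hn : 1 ≤ n)
    (D : Restricted r c) (X : Pos r → Pos c → ℝ) :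
    (finish r c D X).cost ≤ 38 * (m * n) := by
  have : Nonempty (Pos r) := ⟨⟨⟨0, hm⟩, hr _⟩⟩
  have : Nonempty (Pos c) := ⟨⟨⟨0, hn⟩, hc _⟩⟩
  have h := round_cost_le X D.rPos D.cPos
  rw [card_pos_eq hr, card_pos_eq hc] at h
  simp only [finish, extend, Timed.bind_cost, Timed.pure_cost, Timed.tabulate, Finset.sum_const,
    Finset.card_univ, smul_eq_mul, Fintype.card_fin]
  nlinarith

end

end EntropicOT

end

/-! ### The main theorem -/

theorem mainTheorem9 :
    ∃ (A : ℝ) (p : ℕ),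
      ∀ (m n : ℕ) (r : Fin m → ℝ) (c : Fin n → ℝ) (C : Fin m → Fin n → ℝ) (ξ ε : ℝ),
        r ∈ stdSimplex ℝ (Fin m) → c ∈ stdSimplex ℝ (Fin n) →
        (∀ i, 0 < r i) → (∀ j, 0 < c j) → (∀ i j, 0 ≤ C i j) → 0 < ξ → 0 < ε → ε < 1 →
        ∃ (Xopt Xhat : Fin m → Fin n → ℝ) (T : ℕ),
          (∀ X, EntropicOT.IsOptimal r c C ξ X ↔ X = Xopt) ∧
          EntropicOT.ApproxOTRuns r c C ξ ε Xhat T ∧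
          Xhat ∈ EntropicOT.couplings r c ∧
          EntropicOT.norm1 (fun i j => Xhat i j - Xopt i j) ≤ ε ∧
          (T : ℝ) ≤ A * (1 + Real.log ((m : ℝ) * n)) ^ p *
            ((m : ℝ) * n * (ε ^ 4)⁻¹ * (ξ * EntropicOT.normInf C) *
                (ξ ^ 2 * EntropicOT.normInf C ^ 2 +
                  Real.log (EntropicOT.minEntry r c)⁻¹ ^ 2) +
              (m : ℝ) * n) := by
  -- 68200 = 31 · 2200: each pass with its test costs at most 31mn steps. The remaining 102 + 40 +
  -- 38 multiples of mn are absorbed by the summand mn, and no power of 1 + log(mn) is needed.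
  refine ⟨68200, 0, fun m n r c C ξ ε hr1 hc1 hr hc hC hξ hε hε1 => ?_⟩
  have hm : 1 ≤ m := Nat.one_le_iff_ne_zero.2 fun h => by
    subst h
    simpa using hr1.2
  have hn : 1 ≤ n := Nat.one_le_iff_ne_zero.2 fun h => by
    subst h
    simpa using hc1.2
  have hne : Nonempty (EntropicOT.Pos r) := ⟨⟨⟨0, hm⟩, hr _⟩⟩
  have hne' : Nonempty (EntropicOT.Pos c) := ⟨⟨⟨0, hn⟩, hc _⟩⟩
  have h := EntropicOT.isKernelBound_exp (r := fun i : EntropicOT.Pos r => r i)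
    (c := fun j : EntropicOT.Pos c => c j) (C := fun i j => C i j) (fun i => i.2) (fun j => j.2)
    (by rw [EntropicOT.sum_pos_eq hr]; exact hr1.2) (by rw [EntropicOT.sum_pos_eq hc]; exact hc1.2)
    (fun i j => hC i j) hξ
  obtain ⟨X, u, v, hX, hXc⟩ := EntropicOT.exists_isScaling_coupling h
  obtain ⟨X', t, hrun, hcoup, hnear, ht⟩ :=
    EntropicOT.exists_sinkhornRuns_round h hX hXc hε hε1
  have hprep := EntropicOT.prepare_val r c C ξ ε
  have hfin : (EntropicOT.finish r c (EntropicOT.prepare r c C ξ ε).val X').val = fun i j =>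
      (EntropicOT.round X' (fun i : EntropicOT.Pos r => r i)
        (fun j : EntropicOT.Pos c => c j)).val ⟨i, hr i⟩ ⟨j, hc j⟩ := by
    rw [hprep]
    exact funext fun i => funext fun j => EntropicOT.finish_val hr hc _ X' i j
  refine ⟨fun i j => X ⟨i, hr i⟩ ⟨j, hc j⟩,
    (EntropicOT.finish r c (EntropicOT.prepare r c C ξ ε).val X').val, _, fun Z => ?_,
    ⟨X', t, ?_, rfl, rfl⟩, ?_, ?_, ?_⟩
  · exact EntropicOT.isOptimal_iff_of_isScaling hξ (u := fun i => u ⟨i, hr i⟩)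
      (v := fun j => v ⟨j, hc j⟩) (fun i j => hX _ _) (EntropicOT.mem_couplings_of_pos hr hc hXc)
      hr1.2
  · rw [hprep]
    exact hrun
  · rw [hfin]
    exact EntropicOT.mem_couplings_of_pos hr hc hcoup
  · rw [EntropicOT.norm1_pos_eq hr hc] at hnear
    rw [hfin]
    exact hnear
  · have h1 := EntropicOT.prepare_cost_le (C := C) (ξ := ξ) (ε := ε) hr hc hm hn
    have h2 := EntropicOT.finish_cost_le hr hc hm hn (EntropicOT.prepare r c C ξ ε).val X'
    rw [EntropicOT.normInf_pos_eq hr hc, EntropicOT.minEntry_pos_eq hr hc,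
      EntropicOT.card_pos_eq hr, EntropicOT.card_pos_eq hc] at ht
    have h1' : ((EntropicOT.prepare r c C ξ ε).cost : ℝ) ≤ 40 * (m * n) := by exact_mod_cast h1
    have h2' : ((EntropicOT.finish r c (EntropicOT.prepare r c C ξ ε).val X').cost : ℝ)
        ≤ 38 * (m * n) := by exact_mod_cast h2
    have hmn : (0 : ℝ) ≤ m * n := by positivity
    rw [pow_zero, mul_one]
    push_cast
    rw [mul_pow] at ht
    have hq : (m : ℝ) * n * (ε ^ 4)⁻¹ * (ξ * EntropicOT.normInf C) *
        (ξ ^ 2 * EntropicOT.normInf C ^ 2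
        + Real.log (EntropicOT.minEntry r c)⁻¹ ^ 2) = (ε ^ 4)⁻¹ * (ξ * EntropicOT.normInf C)
        * (ξ ^ 2 * EntropicOT.normInf C ^ 2 + Real.log (EntropicOT.minEntry r c)⁻¹ ^ 2)
        * (m * n) := by ring
    rw [hq]
    linarith
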